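/- **Notation.** For $q\in\mathbb{Q}_\infty=\mathbb{Q}\cup\{\infty\}$ (ordered with $\infty$ as largest element) write $q=\frac{d(q)}{r(q)}$ in lowest terms with $r(q)\ge 0$, where $\infty=\frac10$. Two elements $q,q'$ are Farey neighbors if $|d(q)r(q')-d(q')r(q)|=1$; then $q\oplus q'=\frac{d(q)+d(q')}{r(q)+r(q')}$ and $q\ominus q'=\frac{d(q)-d(q')}{r(q)-r(q')}$. A *Farey triple* $[q_0,q_{-1},q_\infty]$ consists of three pairwise Farey neighbors, considered up to permutation and always written in the order $[\frac{even}{odd},\frac{odd}{odd},\frac{odd}{even}]$. The *mutation* $\mu_k$, $k\in\{0,-1,\infty\}$, replaces $q_k$ by $p\ominus p'$ if $q_k$ lies between the two other components $p,p'$, and by $p\oplus p'$ otherwise. Let $\mathbb{T}_3$ be the graph whose vertices are the Farey triples and whose edges connect triples related by one mutation, and let $\mathbb{T}_3^{-1}$ be the connected component of $\mathbb{T}_3\setminus\{[\frac01,\frac{-1}1,\frac10]\}$ that contains $\mu_{-1}[\frac01,\frac{-1}1,\frac10]=[\frac01,\frac11,\frac10]$. Let $\mathcal{A}_M$ be the Markov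 cluster algebra with principal coefficients, with initial cluster $x_1,x_2,x_3$, coefficient variables $x_4,x_5,x_6$, and initial extended exchange matrix $\tilde B_0$ whose principal part is $B^+=\begin{pmatrix}0&-2&2\\2&0&-2\\-2&2&0\end{pmatrix}$ and whose lower part is the identity; its three columns (mutation directions $1,2,3$) are labelled $0,-1,\infty$. Seed mutation $\mu_k$ changes $(b_{ij})$ into $b'_{ij}=-b_{ij}$ if $i=k$ or $j=k$ and $b'_{ij}=b_{ij}+\mathrm{sgn}(b_{ik})\max(b_{ik}b_{kj},0)$ otherwise, and replaces $x_k$ by $x_k'$ with $x_k'x_k=\prod_i x_i^{\max(b_{ik},0)}+\prod_i x_i^{\max(-b_{ik},0)}$. Grade by $\mathbb{Z}^3$: $\deg x_j=\mathbf e_j$ and $\deg x_{3+j}=-(\text{the } j\text{-th column of } B^+)$ for $1\le j\le 3$, extended to quotients of homogeneous polynomials. The *$\mathbf g$-matrix* of a seed is the integer $3\times3$ matrix whose $j$-th column is the degree of its $j$-th cluster variable (as a rational function in $x_1,\dots,x_6$). To a Farey triple $T=\mu_{a_n}\cdots\mu_{a_1}[\frac01,\frac{-1}1,\frac10]$ one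 associates the $\mathbf g$-matrix of the seed $\mu_{a_n}\cdots\mu_{a_1}$(initial seed). **Theorem.** Let $[q_0,q_{-1},q_\infty]\in\mathbb{T}_3^{-1}$. Then there is exactly one $\mathbf g$-matrix $M$ associated to this triple (in particular $M$ does not depend on the choice of $a_1,\dots,a_n$), exactly one of the following three cases occurs, and $M$ is as follows. (i) If $[q_0,q_{-1},q_\infty]=[\frac a1,\frac{a-1}1,\frac10]$, then $M=\begin{pmatrix}a+1&a&0\\-a&-a+1&0\\0&0&1\end{pmatrix}$. (ii) If $[q_0,q_{-1},q_\infty]=[\frac a1,\frac{a+1}1,\frac10]$, then $M=\begin{pmatrix}a+1&a+2&0\\-a&-(a+1)&0\\0&0&1\end{pmatrix}$. (iii) If $q_0=\frac ab$, $q_{-1}=\frac cd$, $q_\infty=\frac ef$ (in lowest terms with nonnegative denominators) and $q_\infty\neq\frac10$, then $M=\begin{pmatrix}a+1&c+1&e+1\\b-a-1&d-c-1&f-e-1\\1-b&1-d&1-f\end{pmatrix}$. -/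

import Mathlib

namespace Farey

/-! ### Extended rational numbers and Farey neighbors -/

/-- `ℚ ∪ {∞}` with its total order; `∞ = ⊤` is the largest element. -/
abbrev ExtRat : Type := WithTop ℚ

/-- The numerator of the reduced fraction, with `∞ = 1/0`. -/
def num : ExtRat → ℤ
  | none => 1
  | some q => q.num

/-- The (nonnegative) denominator of the reduced fraction, with `∞ = 1/0`. -/
def den : ExtRat → ℤ
  | none => 0
  | some q => q.den

/-- The extended rational number `a / b`, where `a / 0 = ∞` (used only for `a ≠ 0` or `b ≠ 0`). -/
def frac (a b : ℤ) : ExtRat := if b = 0 then ⊤ else (((a : ℚ) / (b : ℚ) : ℚ) : ExtRat)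

/-- `Δ(p, q)`, the absolute value of the determinant of numerators and denominators. -/
def delta (p q : ExtRat) : ℤ := |(!![num p, num q; den p, den q]).det|

/-- Farey neighbors. -/
def Neighbors (p q : ExtRat) : Prop := delta p q = 1

/-- The Farey sum. -/
def fareySum (p q : ExtRat) : ExtRat := frac (num p + num q) (den p + den q)

/-- The Farey difference. -/
def fareyDiff (p q : ExtRat) : ExtRat := frac (num p - num q) (den p - den q)

/-! ### Farey triples and their mutations -/

/-- The parity class attached to each position: `0` for even/odd, `1` for odd/odd
and `2` for odd/even. These positions stand for the labels `0`, `-1` and `∞`. -/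
def HasParity (i : Fin 3) (q : ExtRat) : Prop :=
  match i with
  | 0 => Even (num q) ∧ Odd (den q)
  | 1 => Odd (num q) ∧ Odd (den q)
  | 2 => Odd (num q) ∧ Even (den q)

/-- A Farey triple, i.e. three pairwise Farey neighbors up to permutation. The three components
of such a triple lie in the three different parity classes, and the triple is represented by its
unique arrangement in the order `[even/odd, odd/odd, odd/even]`. -/
@[ext]
structure FareyTriple where
  q : Fin 3 → ExtRat
  neighbors : ∀ i j, i ≠ j → Neighbors (q i) (q j)
  parity : ∀ i, HasParity i (q i)

/-- The new component under mutation of the component `x`, where `y` and `z` are the other two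
components: the Farey difference of `y` and `z` if `x` is the middle one of the three,
and their Farey sum if `x` is the smallest or the largest one. -/
def newComponent (x y z : ExtRat) : ExtRat :=
  if (y < x ∧ x < z) ∨ (z < x ∧ x < y) then fareyDiff y z else fareySum y z

theorem frac_of_isCoprime {a b : ℤ} (h : IsCoprime a b) :
    ∃ e : ℤ, (e = 1 ∨ e = -1) ∧ num (frac a b) = e * a ∧ den (frac a b) = e * b := by
  rcases lt_trichotomy b 0 with hb | rfl | hb
  · have hc : Nat.Coprime (-a).natAbs (-b).natAbs := by
      simpa using Int.isCoprime_iff_nat_coprime.mp h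
    have h1 := Rat.num_div_eq_of_coprime (neg_pos.mpr hb) hc
    have h2 := Rat.den_div_eq_of_coprime (neg_pos.mpr hb) hc
    push_cast at h1 h2
    rw [neg_div_neg_eq] at h1 h2
    refine ⟨-1, Or.inr rfl, ?_, ?_⟩
    · simp only [frac, if_neg hb.ne]
      exact h1.trans (by ring)
    · simp only [frac, if_neg hb.ne]
      exact h2.trans (by ring)
  · have ha : IsUnit a := isCoprime_zero_right.mp h
    rcases Int.isUnit_iff.mp ha with rfl | rfl
    · exact ⟨1, Or.inl rfl, rfl, rfl⟩
    · exact ⟨-1, Or.inr rfl, rfl, rfl⟩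
  · have hc : Nat.Coprime a.natAbs b.natAbs := Int.isCoprime_iff_nat_coprime.mp h
    refine ⟨1, Or.inl rfl, ?_, ?_⟩
    · simp only [frac, if_neg hb.ne']
      exact (Rat.num_div_eq_of_coprime hb hc).trans (by ring)
    · simp only [frac, if_neg hb.ne']
      exact (Rat.den_div_eq_of_coprime hb hc).trans (by ring)

theorem neighbors_iff (p q : ExtRat) :
    Neighbors p q ↔ num p * den q - num q * den p = 1 ∨ num p * den q - num q * den p = -1 := by
  rw [Neighbors, delta, Matrix.det_fin_two_of, abs_eq zero_le_one]

theorem newComponent_spec (x : ExtRat) {y z : ExtRat} (h : Neighbors y z) :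
    ∃ e s : ℤ, (e = 1 ∨ e = -1) ∧ (s = 1 ∨ s = -1) ∧
      num (newComponent x y z) = e * (num y + s * num z) ∧
      den (newComponent x y z) = e * (den y + s * den z) := by
  have key : ∀ s : ℤ, IsCoprime (num y + s * num z) (den y + s * den z) := by
    intro s
    rcases (neighbors_iff y z).mp h with h | h
    · exact ⟨den z, -num z, by linear_combination h⟩
    · exact ⟨-den z, num z, by linear_combination -h⟩
  unfold newComponent
  split_ifs
  · obtain ⟨e, he, h1, h2⟩ := frac_of_isCoprime (key (-1))
    refine ⟨e, -1, he, Or.inr rfl, ?_, ?_⟩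
    · rw [← h1, fareyDiff]; congr 2 <;> ring
    · rw [← h2, fareyDiff]; congr 2 <;> ring
  · obtain ⟨e, he, h1, h2⟩ := frac_of_isCoprime (key 1)
    refine ⟨e, 1, he, Or.inl rfl, ?_, ?_⟩
    · rw [← h1, fareySum]; congr 2 <;> ring
    · rw [← h2, fareySum]; congr 2 <;> ring

theorem neighbors_comm {p q : ExtRat} (h : Neighbors p q) : Neighbors q p := by
  rw [neighbors_iff] at h ⊢
  rcases h with h | h
  · right; linarith
  · left; linarith

theorem newComponent_neighbors_left (x : ExtRat) {y z : ExtRat} (h : Neighbors y z) :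
    Neighbors (newComponent x y z) y := by
  obtain ⟨e, s, he, hs, h1, h2⟩ := newComponent_spec x h
  rw [neighbors_iff] at h ⊢
  rw [h1, h2]
  rcases he with rfl | rfl <;> rcases hs with rfl | rfl <;> rcases h with h | h <;>
    first
    | (left; linarith)
    | (right; linarith)

theorem newComponent_neighbors_right (x : ExtRat) {y z : ExtRat} (h : Neighbors y z) :
    Neighbors (newComponent x y z) z := by
  obtain ⟨e, s, he, hs, h1, h2⟩ := newComponent_spec x h
  rw [neighbors_iff] at h ⊢
  rw [h1, h2]
  rcases he with rfl | rfl <;> rcases hs with rfl | rfl <;> rcases h with h | h <;>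
    first
    | (left; linarith)
    | (right; linarith)

theorem newComponent_parity (x : ExtRat) {y z : ExtRat} (h : Neighbors y z) (k : Fin 3)
    (hy : HasParity (k + 1) y) (hz : HasParity (k + 2) z) :
    HasParity k (newComponent x y z) := by
  obtain ⟨e, s, he, hs, h1, h2⟩ := newComponent_spec x h
  have he' : Odd e := by rcases he with rfl | rfl <;> decide
  have hs' : Odd s := by rcases hs with rfl | rfl <;> decide
  fin_cases k <;> simp [HasParity] at hy hz ⊢ <;>
    simp only [h1, h2, Int.even_mul, Int.even_add, ← Int.not_even_iff_odd] at hy hz he' hs' ⊢ <;>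
    tauto

/-- Mutation of a Farey triple in the direction of its component of parity class `k`. -/
def FareyTriple.mutate (T : FareyTriple) (k : Fin 3) : FareyTriple where
  q := Function.update T.q k (newComponent (T.q k) (T.q (k + 1)) (T.q (k + 2)))
  neighbors := by
    have hn : Neighbors (T.q (k + 1)) (T.q (k + 2)) :=
      T.neighbors _ _ (by fin_cases k <;> decide)
    have hk : ∀ j, j ≠ k →
        Neighbors (newComponent (T.q k) (T.q (k + 1)) (T.q (k + 2))) (T.q j) := by
      intro j hj
      have : j = k + 1 ∨ j = k + 2 :=
        (by decide : ∀ k j : Fin 3, j ≠ k → j = k + 1 ∨ j = k + 2) k j hj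
      rcases this with rfl | rfl
      · exact newComponent_neighbors_left _ hn
      · exact newComponent_neighbors_right _ hn
    intro i j hij
    by_cases hi : i = k
    · subst hi
      rw [Function.update_self, Function.update_of_ne hij.symm]
      exact hk j hij.symm
    · by_cases hj : j = k
      · subst hj
        rw [Function.update_self, Function.update_of_ne hij]
        exact neighbors_comm (hk i hij)
      · rw [Function.update_of_ne hi, Function.update_of_ne hj]
        exact T.neighbors i j hij
  parity := by
    intro i
    by_cases hi : i = k
    · subst hi
      rw [Function.update_self]
      exact newComponent_parity _ (T.neighbors _ _ (by fin_cases i <;> decide)) i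
        (T.parity _) (T.parity _)
    · rw [Function.update_of_ne hi]
      exact T.parity i

/-- The initial Farey triple `[0/1, -1/1, 1/0]`. -/
def FareyTriple.initial : FareyTriple where
  q := ![((0 : ℚ) : ExtRat), ((-1 : ℚ) : ExtRat), ⊤]
  neighbors := by
    intro i j hij
    rw [neighbors_iff]
    fin_cases i <;> fin_cases j <;> first | exact absurd rfl hij | exact Or.inl rfl | exact Or.inr rfl
  parity := by
    intro i
    fin_cases i <;> exact ⟨by decide, by decide⟩

/-- `μ_{aₙ} ⋯ μ_{a₁} T` for the word `[a₁, …, aₙ]`. -/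
def FareyTriple.mutateWord (T : FareyTriple) (w : List (Fin 3)) : FareyTriple :=
  w.foldl FareyTriple.mutate T

/-- The exchange graph of the Farey triples: edges connect triples related by one mutation. -/
def exchangeGraph : SimpleGraph FareyTriple :=
  SimpleGraph.fromRel fun T T' => ∃ k, T' = T.mutate k

/-- The connected component, in the exchange graph with the initial triple removed, of the triple
obtained from the initial one by mutation in direction `i`. -/
def branch (i : Fin 3) : Set FareyTriple :=
  {T | ∃ (hS : FareyTriple.initial.mutate i ≠ FareyTriple.initial)
      (hT : T ≠ FareyTriple.initial),
    (exchangeGraph.induce {U | U ≠ FareyTriple.initial}).Reachable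
      ⟨FareyTriple.initial.mutate i, hS⟩ ⟨T, hT⟩}

end Farey

namespace Cluster

open MvPolynomial

variable {ι : Type} [Fintype ι] [DecidableEq ι]

/-! ### Seeds with coefficients

The index type `ι ⊕ ι` enumerates the variables `x₁, …, xₙ` (`Sum.inl`) and the coefficient
variables `xₙ₊₁, …, x₂ₙ` (`Sum.inr`). -/

/-- The ambient field `ℚ(x₁, …, x₂ₙ)`. -/
abbrev Ambient (ι : Type) : Type := FractionRing (MvPolynomial (ι ⊕ ι) ℚ)

/-- The element `xᵢ` of the ambient field. -/
noncomputable def gen (i : ι ⊕ ι) : Ambient ι := algebraMap (MvPolynomial (ι ⊕ ι) ℚ) (Ambient ι) (X i)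

/-- An extended exchange matrix together with a cluster. Below, only the seeds obtained by
mutation from an initial seed with skew-symmetric principal part and cluster `x₁, …, xₙ` occur. -/
structure Seed (ι : Type) where
  mat : Matrix (ι ⊕ ι) ι ℤ
  var : ι → Ambient ι

/-- Mutation of extended exchange matrices. -/
def mutateMatrix (B : Matrix (ι ⊕ ι) ι ℤ) (k : ι) : Matrix (ι ⊕ ι) ι ℤ :=
  Matrix.of fun i j =>
    if i = Sum.inl k ∨ j = k then -B i j
    else B i j + (B i k).sign * max (B i k * B (Sum.inl k) j) 0

/-- The cluster variables of a seed followed by the coefficient variables. -/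
noncomputable def Seed.extVar (S : Seed ι) : ι ⊕ ι → Ambient ι :=
  Sum.elim S.var fun i => gen (Sum.inr i)

/-- Seed mutation; the new variable is given by the exchange relation
`x'ₖ xₖ = ∏ xᵢ ^ [bᵢₖ]₊ + ∏ xᵢ ^ [-bᵢₖ]₊`. -/
noncomputable def Seed.mutate (S : Seed ι) (k : ι) : Seed ι where
  mat := mutateMatrix S.mat k
  var := Function.update S.var k
    ((∏ i, S.extVar i ^ (max (S.mat i k) 0).toNat
      + ∏ i, S.extVar i ^ (max (-S.mat i k) 0).toNat) / S.var k)

/-- `μ_{aₙ} ⋯ μ_{a₁} S` for the word `[a₁, …, aₙ]`. -/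
noncomputable def Seed.mutateWord (S : Seed ι) (w : List ι) : Seed ι := w.foldl Seed.mutate S

/-- The initial seed with principal coefficients and principal part `B`. -/
noncomputable def initialSeed (B : Matrix ι ι ℤ) : Seed ι where
  mat := Matrix.fromRows B 1
  var := fun i => gen (Sum.inl i)

/-! ### The grading and the g-vectors -/

/-- The natural `ℤⁿ`-grading: `xⱼ` has degree `eⱼ` and the coefficient variable `xₙ₊ⱼ` has as degree
the negative of the `j`-th column of `B`. -/
def degWeight (B : Matrix ι ι ℤ) : ι ⊕ ι → (ι → ℤ) :=
  Sum.elim (fun j => Pi.single j 1) fun j i => -B i j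

/-- `f` is a nonzero homogeneous rational function of degree `g`: a quotient of nonzero homogeneous
polynomials whose degrees differ by `g`. On Laurent polynomials this is homogeneity of degree `g` in
the usual sense, see `hasDegree_div_monomial_iff`. -/
def HasDegree (B : Matrix ι ι ℤ) (f : Ambient ι) (g : ι → ℤ) : Prop :=
  ∃ (P Q : MvPolynomial (ι ⊕ ι) ℚ) (m n : ι → ℤ), P ≠ 0 ∧ Q ≠ 0 ∧
    IsWeightedHomogeneous (degWeight B) P m ∧ IsWeightedHomogeneous (degWeight B) Q n ∧
    f = algebraMap _ (Ambient ι) P / algebraMap _ (Ambient ι) Q ∧ g = m - n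

theorem isWeightedHomogeneous_of_mul {σ : Type} {w : σ → ι → ℤ} {P Q : MvPolynomial σ ℚ}
    {k n : ι → ℤ} (hQ : Q ≠ 0) (hn : IsWeightedHomogeneous w Q n)
    (hk : IsWeightedHomogeneous w (P * Q) k) : IsWeightedHomogeneous w P (k - n) := by
  classical
  let := weightedGradedAlgebra ℚ w
  have key : ∀ m, weightedHomogeneousComponent w m P * Q
      = weightedHomogeneousComponent w (m + n) (P * Q) := fun m => by
    have h := DirectSum.coe_decompose_mul_add_of_right_mem
      (weightedHomogeneousSubmodule ℚ w) (a := P) (b := Q) (i := m) hn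
    rw [← weightedDecomposition.decompose'_apply, ← weightedDecomposition.decompose'_apply]
    exact h.symm
  intro d hd
  by_contra hne
  have h0 : weightedHomogeneousComponent w (Finsupp.weight w d + n) (P * Q) = 0 :=
    hk.weightedHomogeneousComponent_ne _ fun h => hne (eq_sub_of_add_eq h)
  have h1 := key (Finsupp.weight w d)
  rw [h0] at h1
  have h2 := (mul_eq_zero.mp h1).resolve_right hQ
  apply hd
  have h3 := congrArg (coeff d) h2
  rwa [coeff_weightedHomogeneousComponent, if_pos rfl, coeff_zero] at h3

theorem hasDegree_div_monomial_iff (B : Matrix ι ι ℤ) (P : MvPolynomial (ι ⊕ ι) ℚ)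
    (s : ι ⊕ ι →₀ ℕ) (g : ι → ℤ) :
    HasDegree B (algebraMap _ (Ambient ι) P / algebraMap _ (Ambient ι) (monomial s (1 : ℚ))) g ↔
      P ≠ 0 ∧ IsWeightedHomogeneous (degWeight B) P (g + Finsupp.weight (degWeight B) s) := by
  have hs : monomial s (1 : ℚ) ≠ 0 := by simp
  have hsw : IsWeightedHomogeneous (degWeight B) (monomial s (1 : ℚ))
      (Finsupp.weight (degWeight B) s) := isWeightedHomogeneous_monomial _ _ _ rfl
  have inj := IsFractionRing.injective (MvPolynomial (ι ⊕ ι) ℚ) (Ambient ι)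
  constructor
  · rintro ⟨P', Q', m, n, hP', hQ', hm, hn, h, rfl⟩
    rw [div_eq_div_iff (by simp) (by simpa using hQ'), ← map_mul, ← map_mul] at h
    have h := inj h
    refine ⟨?_, ?_⟩
    · rintro rfl
      rw [zero_mul, eq_comm] at h
      exact (mul_ne_zero hP' hs) h
    · have := isWeightedHomogeneous_of_mul hQ' hn (h ▸ hm.mul hsw)
      convert this using 1
      abel
  · rintro ⟨hP, h⟩
    exact ⟨P, monomial s 1, _, _, hP, hs, h, hsw, rfl, by abel⟩

/-- `G` is the g-matrix of the seed `S`, where `B` is the initial exchange matrix: its `j`-th column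
is the degree of the `j`-th cluster variable of `S`. -/
def IsGMatrix (B : Matrix ι ι ℤ) (S : Seed ι) (G : Matrix ι ι ℤ) : Prop :=
  ∀ j, HasDegree B (S.var j) fun i => G i j

end Cluster

namespace Markov

open Farey Cluster

/-- The principal part `B⁺` of the initial exchange matrix of the Markov cluster algebra; rows and
columns are indexed by `0, -1, ∞`, in this order. -/
def exchangeMatrix : Matrix (Fin 3) (Fin 3) ℤ := !![0, -2, 2; 2, 0, -2; -2, 2, 0]

/-- `M` is a g-matrix associated to the Farey triple `T`: for some word in the directions
`0, -1, ∞` that leads from the initial triple to `T`, it is the g-matrix of the seed to which the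
same word leads from the initial seed of the Markov cluster algebra with principal coefficients. -/
def IsAssociatedGMatrix (T : FareyTriple) (M : Matrix (Fin 3) (Fin 3) ℤ) : Prop :=
  ∃ w : List (Fin 3), FareyTriple.initial.mutateWord w = T ∧
    IsGMatrix exchangeMatrix ((initialSeed exchangeMatrix).mutateWord w) M

end Markov

/-! Read `∞` as `-1/0` (`lowNum`) and let a component with numerator `n` and denominator `d` be the
vector `(n, d)`. Then `(n + 1, d - n - 1, 1 - d)` is the g-vector in all three cases at once, and it
is an affine function of the component. If `x` mutates to `x'` beside `y` and `z`, one of `x`, `x'`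
is `y + z` and the other is `δ (z - y)` with `δ = ±1`. Hence `x + x'` is `2z` or `2y`, and the
affine map carries this over to g-vectors.

On the cluster side, mutation only negates the principal part, so the exchange relation is a sum of
the squares of the two other variables, each times a coefficient monomial. If the c-vector is
sign-coherent, one monomial carries no coefficients, and the new degree is twice one of the other
g-vectors minus the old one. It remains to see that the c-vector selects the same neighbor as `δ`.
This follows from a closed formula `cVec` for the c-vectors: `exists_sign_mutate` gives its mutation
rule, `sign_coherence` its sign, and `sum_cVec_mul` the homogeneity of the relation. The invariant
`Describes` thus survives mutations inside `[0, ∞]`.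

For independence of the word, both kinds of mutation are involutions, so words may be reduced. A
nonempty reduced word never returns to the initial triple, because the height built from `a² + ab +
b²` grows along it. The only edge between triples in `[0, ∞]` and the others ends at the initial
triple. So a reduced word that ends in `[0, ∞]` enters it at its first step and stays there. -/

namespace Cluster

open MvPolynomial

variable {ι : Type}

/-! ### Homogeneous rational functions -/

section HasDegree

variable [DecidableEq ι]

/-- After cross-multiplication this is the uniqueness of the weighted degree of a nonzero
polynomial. The uniqueness of the g-matrix rests on it. -/
theorem HasDegree.unique {B : Matrix ι ι ℤ} {f : Ambient ι} {g g' : ι → ℤ}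
    (h : HasDegree B f g) (h' : HasDegree B f g') : g = g' := by
  obtain ⟨P, Q, m, n, hP, hQ, hm, hn, rfl, rfl⟩ := h
  obtain ⟨P', Q', m', n', hP', hQ', hm', hn', h, rfl⟩ := h'
  have inj := IsFractionRing.injective (MvPolynomial (ι ⊕ ι) ℚ) (Ambient ι)
  rw [div_eq_div_iff (by simpa using hQ) (by simpa using hQ'), ← map_mul, ← map_mul] at h
  have h := inj h
  have h1 := hm.mul hn'
  have h2 := hm'.mul hn
  rw [h] at h1
  have := h1.inj_right (mul_ne_zero hP' hQ) h2
  rw [sub_eq_sub_iff_add_eq_add]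
  exact this

theorem HasDegree.mul {B : Matrix ι ι ℤ} {f f' : Ambient ι} {g g' : ι → ℤ}
    (h : HasDegree B f g) (h' : HasDegree B f' g') : HasDegree B (f * f') (g + g') := by
  obtain ⟨P, Q, m, n, hP, hQ, hm, hn, rfl, rfl⟩ := h
  obtain ⟨P', Q', m', n', hP', hQ', hm', hn', rfl, rfl⟩ := h'
  exact ⟨P * P', Q * Q', m + m', n + n', mul_ne_zero hP hP', mul_ne_zero hQ hQ', hm.mul hm',
    hn.mul hn', by rw [div_mul_div_comm, map_mul, map_mul], by abel⟩

theorem HasDegree.div {B : Matrix ι ι ℤ} {f f' : Ambient ι} {g g' : ι → ℤ}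
    (h : HasDegree B f g) (h' : HasDegree B f' g') : HasDegree B (f / f') (g - g') := by
  obtain ⟨P, Q, m, n, hP, hQ, hm, hn, rfl, rfl⟩ := h
  obtain ⟨P', Q', m', n', hP', hQ', hm', hn', rfl, rfl⟩ := h'
  exact ⟨P * Q', Q * P', m + n', n + m', mul_ne_zero hP hQ', mul_ne_zero hQ hP', hm.mul hn',
    hn.mul hm', by rw [div_div_div_eq, map_mul, map_mul], by abel⟩

theorem HasDegree.add {B : Matrix ι ι ℤ} {f f' : Ambient ι} {g : ι → ℤ}
    (h : HasDegree B f g) (h' : HasDegree B f' g) (hne : f + f' ≠ 0) :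
    HasDegree B (f + f') g := by
  obtain ⟨P, Q, m, n, hP, hQ, hm, hn, rfl, rfl⟩ := h
  obtain ⟨P', Q', m', n', hP', hQ', hm', hn', rfl, hg⟩ := h'
  have hQ0 : algebraMap _ (Ambient ι) Q ≠ 0 := by simpa using hQ
  have hQ0' : algebraMap _ (Ambient ι) Q' ≠ 0 := by simpa using hQ'
  have e : algebraMap _ (Ambient ι) P / algebraMap _ (Ambient ι) Q
      + algebraMap _ (Ambient ι) P' / algebraMap _ (Ambient ι) Q'
      = algebraMap _ (Ambient ι) (P * Q' + Q * P') / algebraMap _ (Ambient ι) (Q * Q') := by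
    rw [div_add_div _ _ hQ0 hQ0', map_add, map_mul, map_mul, map_mul]
  rw [e] at hne ⊢
  have hd : n + m' = m + n' := by
    rw [sub_eq_sub_iff_add_eq_add] at hg
    rw [hg, add_comm]
  refine ⟨_, _, m + n', n + n', ?_, mul_ne_zero hQ hQ', (hm.mul hn').add (hd ▸ hn.mul hm'),
    hn.mul hn', rfl, by abel⟩
  intro h0
  rw [h0, map_zero, zero_div] at hne
  exact hne rfl

theorem HasDegree.one (B : Matrix ι ι ℤ) : HasDegree B 1 0 :=
  ⟨1, 1, 0, 0, one_ne_zero, one_ne_zero, isWeightedHomogeneous_one _ _,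
    isWeightedHomogeneous_one _ _, by simp, by simp⟩

theorem hasDegree_gen (B : Matrix ι ι ℤ) (i : ι ⊕ ι) : HasDegree B (gen i) (degWeight B i) :=
  ⟨X i, 1, _, 0, X_ne_zero _, one_ne_zero, isWeightedHomogeneous_X _ _ _,
    isWeightedHomogeneous_one _ _, by simp [gen], by simp⟩

theorem HasDegree.pow {B : Matrix ι ι ℤ} {f : Ambient ι} {g : ι → ℤ} (h : HasDegree B f g)
    (n : ℕ) : HasDegree B (f ^ n) (n • g) := by
  induction n with
  | zero => simpa using HasDegree.one B
  | succ n ih => rw [pow_succ, succ_nsmul]; exact ih.mul h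

theorem HasDegree.prod {B : Matrix ι ι ℤ} {κ : Type} (s : Finset κ) {f : κ → Ambient ι}
    {g : κ → ι → ℤ} (h : ∀ i, HasDegree B (f i) (g i)) :
    HasDegree B (∏ i ∈ s, f i) (∑ i ∈ s, g i) := by
  classical
  induction s using Finset.induction_on with
  | empty => simpa using HasDegree.one B
  | insert i s hi ih => rw [Finset.prod_insert hi, Finset.sum_insert hi]; exact (h i).mul ih

/-- The degree of a cluster monomial with exponents the positive parts of `e`. -/
theorem hasDegree_prod_pow [Fintype ι] {B : Matrix ι ι ℤ} {f : ι ⊕ ι → Ambient ι}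
    {g : ι ⊕ ι → ι → ℤ}
    (h : ∀ i, HasDegree B (f i) (g i)) (e : ι ⊕ ι → ℤ) :
    HasDegree B (∏ i, f i ^ (max (e i) 0).toNat) (∑ i, max (e i) 0 • g i) := by
  have := HasDegree.prod (B := B) Finset.univ fun i => (h i).pow (max (e i) 0).toNat
  convert this using 2 with i
  rw [← natCast_zsmul, Int.toNat_of_nonneg (le_max_right _ _)]

end HasDegree

/-! ### Positive rational functions -/

/-- A quotient of polynomials that are positive at the point `(1, …, 1)`. -/
def IsPositive (f : Ambient ι) : Prop :=
  ∃ P Q : MvPolynomial (ι ⊕ ι) ℚ, 0 < eval (fun _ => 1) P ∧ 0 < eval (fun _ => 1) Q ∧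
    f = algebraMap _ (Ambient ι) P / algebraMap _ (Ambient ι) Q

theorem algebraMap_ne_zero_of_eval_pos {Q : MvPolynomial (ι ⊕ ι) ℚ}
    (h : 0 < eval (fun _ => 1) Q) : algebraMap _ (Ambient ι) Q ≠ 0 := by
  have : Q ≠ 0 := by rintro rfl; simp at h
  simpa using this

/-- The purpose of positivity: the two monomials of an exchange relation cannot cancel, and one may
divide by every cluster variable. -/
theorem IsPositive.ne_zero {f : Ambient ι} (h : IsPositive f) : f ≠ 0 := by
  obtain ⟨P, Q, hP, hQ, rfl⟩ := h
  exact div_ne_zero (algebraMap_ne_zero_of_eval_pos hP) (algebraMap_ne_zero_of_eval_pos hQ)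

theorem IsPositive.mul {f g : Ambient ι} (hf : IsPositive f) (hg : IsPositive g) :
    IsPositive (f * g) := by
  obtain ⟨P, Q, hP, hQ, rfl⟩ := hf
  obtain ⟨P', Q', hP', hQ', rfl⟩ := hg
  exact ⟨P * P', Q * Q', by rw [map_mul]; positivity, by rw [map_mul]; positivity,
    by rw [div_mul_div_comm, map_mul, map_mul]⟩

theorem IsPositive.div {f g : Ambient ι} (hf : IsPositive f) (hg : IsPositive g) :
    IsPositive (f / g) := by
  obtain ⟨P, Q, hP, hQ, rfl⟩ := hf
  obtain ⟨P', Q', hP', hQ', rfl⟩ := hg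
  exact ⟨P * Q', Q * P', by rw [map_mul]; positivity, by rw [map_mul]; positivity,
    by rw [div_div_div_eq, map_mul, map_mul]⟩

theorem IsPositive.add {f g : Ambient ι} (hf : IsPositive f) (hg : IsPositive g) :
    IsPositive (f + g) := by
  obtain ⟨P, Q, hP, hQ, rfl⟩ := hf
  obtain ⟨P', Q', hP', hQ', rfl⟩ := hg
  refine ⟨P * Q' + Q * P', Q * Q', by rw [map_add, map_mul, map_mul]; positivity,
    by rw [map_mul]; positivity, ?_⟩
  rw [div_add_div _ _ (algebraMap_ne_zero_of_eval_pos hQ) (algebraMap_ne_zero_of_eval_pos hQ'),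
    map_add, map_mul, map_mul, map_mul]

theorem IsPositive.one : IsPositive (1 : Ambient ι) :=
  ⟨1, 1, by simp, by simp, by simp⟩

theorem isPositive_gen (i : ι ⊕ ι) : IsPositive (gen i) :=
  ⟨X i, 1, by simp, by simp, by simp [gen]⟩

theorem IsPositive.pow {f : Ambient ι} (h : IsPositive f) (n : ℕ) : IsPositive (f ^ n) := by
  induction n with
  | zero => simpa using IsPositive.one
  | succ n ih => rw [pow_succ]; exact ih.mul h

theorem IsPositive.prod {κ : Type} (s : Finset κ) {f : κ → Ambient ι}
    (h : ∀ i, IsPositive (f i)) : IsPositive (∏ i ∈ s, f i) := by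
  classical
  induction s using Finset.induction_on with
  | empty => simpa using IsPositive.one
  | insert i s hi ih => rw [Finset.prod_insert hi]; exact (h i).mul ih

/-! ### Seed mutation -/

/-- All cluster variables of the seed are positive rational functions. -/
def Seed.IsPositive (S : Seed ι) : Prop := ∀ i, Cluster.IsPositive (S.var i)

theorem Seed.IsPositive.extVar {S : Seed ι} (h : S.IsPositive) (i : ι ⊕ ι) :
    Cluster.IsPositive (S.extVar i) := by
  rcases i with i | i
  · exact h i
  · exact isPositive_gen _

variable [DecidableEq ι]

theorem Seed.IsPositive.mutate [Fintype ι] {S : Seed ι} (h : S.IsPositive) (k : ι) :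
    (S.mutate k).IsPositive := by
  intro i
  by_cases hi : i = k
  · subst hi
    simp only [Seed.mutate, Function.update_self]
    exact ((IsPositive.prod _ fun i => (h.extVar i).pow _).add
      (IsPositive.prod _ fun i => (h.extVar i).pow _)).div (h _)
  · simp only [Seed.mutate, Function.update_of_ne hi]
    exact h i

/-- Row and column `k` are negated, so the product `b_ik b_kj` is unchanged while the sign of `b_ik`
flips, and the two corrections cancel. -/
theorem mutateMatrix_mutateMatrix (B : Matrix (ι ⊕ ι) ι ℤ) (k : ι) :
    mutateMatrix (mutateMatrix B k) k = B := by
  ext i j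
  simp only [mutateMatrix, Matrix.of_apply]
  split_ifs <;> simp_all

/-- Negating column `k` swaps the two exchange monomials. Neither involves the variable at `k`,
because `b_kk = 0`, so both exchange relations have the same right-hand side. -/
theorem Seed.mutate_mutate [Fintype ι] {S : Seed ι} (k : ι) (hk : S.mat (Sum.inl k) k = 0)
    (hS : S.IsPositive) : (S.mutate k).mutate k = S := by
  have hne := (hS.mutate k k).ne_zero
  have hv := (hS k).ne_zero
  have hvar : ∀ (i : ι ⊕ ι) (n : ℤ), (i = Sum.inl k → n = 0) →
      (S.mutate k).extVar i ^ (max n 0).toNat = S.extVar i ^ (max n 0).toNat := by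
    intro i n hn
    rcases i with i | i
    · by_cases hi : i = k
      · subst hi; simp [hn rfl]
      · simp [Seed.extVar, Seed.mutate, Function.update_of_ne hi]
    · rfl
  have hmat : ∀ i, (S.mutate k).mat i k = -S.mat i k := fun i => by
    simp [Seed.mutate, mutateMatrix]
  obtain ⟨B, x⟩ := S
  have hB : ((Seed.mk B x).mutate k |>.mutate k).mat = B := mutateMatrix_mutateMatrix B k
  have hx : ((Seed.mk B x).mutate k |>.mutate k).var = x := by
    funext i
    by_cases hi : i = k
    · subst hi
      conv_lhs => rw [Seed.mutate]
      simp only [Function.update_self]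
      have e1 : ∀ j, ((Seed.mk B x).mutate i).extVar j
          ^ (max (((Seed.mk B x).mutate i).mat j i) 0).toNat
          = (Seed.mk B x).extVar j ^ (max (-B j i) 0).toNat := fun j => by
        rw [hmat, hvar _ _ (by rintro rfl; simpa using hk)]
      have e2 : ∀ j, ((Seed.mk B x).mutate i).extVar j
          ^ (max (-((Seed.mk B x).mutate i).mat j i) 0).toNat
          = (Seed.mk B x).extVar j ^ (max (B j i) 0).toNat := fun j => by
        rw [hmat, neg_neg, hvar _ _ (by rintro rfl; simpa using hk)]
      simp only [e1, e2]
      simp only [Seed.mutate, Function.update_self] at hne ⊢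
      have hne' := left_ne_zero_of_mul (div_eq_mul_inv _ (x i) ▸ hne)
      rw [add_comm, div_div_eq_mul_div, mul_div_cancel_left₀ _ hne']
    · simp [Seed.mutate, Function.update_of_ne hi]
  calc _ = Seed.mk ((Seed.mk B x).mutate k |>.mutate k).mat
        ((Seed.mk B x).mutate k |>.mutate k).var := rfl
    _ = _ := by rw [hB, hx]

/-- The degree of the cluster variable produced by a homogeneous exchange relation. -/
theorem Seed.hasDegree_mutate [Fintype ι] {A : Matrix ι ι ℤ} {S : Seed ι} (hS : S.IsPositive)
    {g : ι → ι → ℤ} (hg : ∀ i, HasDegree A (S.var i) (g i)) (k : ι)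
    (h0 : ∑ i, S.mat i k • Sum.elim g (fun j => degWeight A (Sum.inr j)) i = 0) :
    HasDegree A ((S.mutate k).var k)
      (∑ i, max (S.mat i k) 0 • Sum.elim g (fun j => degWeight A (Sum.inr j)) i - g k) := by
  have hext : ∀ i, HasDegree A (S.extVar i)
      (Sum.elim g (fun j => degWeight A (Sum.inr j)) i) := by
    rintro (i | i)
    · exact hg i
    · exact hasDegree_gen _ _
  have h1 := hasDegree_prod_pow hext fun i => S.mat i k
  have h2 := hasDegree_prod_pow hext fun i => -S.mat i k
  -- The two monomials have equal degree: `[b]₊ - [-b]₊ = b`, and `h0` says that the degrees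
  -- weighted by `b` sum to zero.
  have e : ∑ i, max (-S.mat i k) 0 • Sum.elim g (fun j => degWeight A (Sum.inr j)) i
      = ∑ i, max (S.mat i k) 0 • Sum.elim g (fun j => degWeight A (Sum.inr j)) i := by
    rw [← sub_eq_zero, ← Finset.sum_sub_distrib, ← neg_eq_zero, ← Finset.sum_neg_distrib, ← h0]
    refine Finset.sum_congr rfl fun i _ => ?_
    rw [← sub_smul, ← neg_smul]
    congr 1
    rcases le_total 0 (S.mat i k) with h | h
    · rw [max_eq_right (by omega), max_eq_left h]; ring
    · rw [max_eq_left (by omega), max_eq_right h]; ring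
  rw [e] at h2
  simp only [Seed.mutate, Function.update_self]
  refine (h1.add h2 (IsPositive.ne_zero ?_)).div (hg k)
  exact (IsPositive.prod _ fun i => (hS.extVar i).pow _).add
      (IsPositive.prod _ fun i => (hS.extVar i).pow _)

end Cluster

namespace Farey

/-! ### Extended rational numbers as integer vectors -/

theorem den_nonneg (q : ExtRat) : 0 ≤ den q := by
  cases q using WithTop.recTopCoe with
  | top => exact le_rfl
  | coe q => exact Int.natCast_nonneg _

theorem eq_top_of_den_eq_zero {q : ExtRat} (h : den q = 0) : q = ⊤ := by
  cases q using WithTop.recTopCoe with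
  | top => rfl
  | coe q => exact absurd (Int.natCast_eq_zero.mp h) q.den_nz

theorem lt_iff_num_mul_den_lt (p q : ExtRat) : p < q ↔ num p * den q < num q * den p := by
  cases p using WithTop.recTopCoe with
  | top =>
    have : ¬ (num ⊤ * den q < num q * den ⊤) := by
      simpa [num, den] using den_nonneg q
    simpa using this
  | coe p =>
    cases q using WithTop.recTopCoe with
    | top =>
      have : num (p : ExtRat) * den ⊤ < num ⊤ * den (p : ExtRat) := by
        have : (0 : ℤ) < p.den := by exact_mod_cast p.pos
        simpa [num, den] using this
      simp [this, WithTop.coe_lt_top]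
    | coe q =>
      rw [WithTop.coe_lt_coe, Rat.lt_iff]
      rfl

theorem ext_of_num_den {p q : ExtRat} (hn : num p = num q) (hd : den p = den q) : p = q := by
  rcases lt_trichotomy p q with h | h | h
  · rw [lt_iff_num_mul_den_lt, hn, hd] at h; exact absurd h (lt_irrefl _)
  · exact h
  · rw [lt_iff_num_mul_den_lt, hn, hd] at h; exact absurd h (lt_irrefl _)

/-- Denominators are nonnegative, so `e = -1` forces both to vanish, and both elements are `∞`.
Signs of vectors can therefore be left undetermined in computations. -/
theorem ext_of_num_den_smul {p q : ExtRat} {e : ℤ} (he : e = 1 ∨ e = -1)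
    (hn : num p = e * num q) (hd : den p = e * den q) : p = q := by
  rcases he with rfl | rfl
  · exact ext_of_num_den (by simpa using hn) (by simpa using hd)
  · have hp := den_nonneg p
    have hq := den_nonneg q
    rw [eq_top_of_den_eq_zero (q := p) (by omega), eq_top_of_den_eq_zero (q := q) (by omega)]

/-- The value and the mutated value of a component of a Farey triple in terms of
the other two components. -/
theorem newComponent_of_neighbors {x y z : ExtRat} (hyz : Neighbors y z) (hxy : Neighbors x y)
    (hxz : Neighbors x z) :
    ∃ e e' s : ℤ, (e = 1 ∨ e = -1) ∧ (e' = 1 ∨ e' = -1) ∧ (s = 1 ∨ s = -1) ∧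
      num x = e * (num y + s * num z) ∧ den x = e * (den y + s * den z) ∧
      num (newComponent x y z) = e' * (num y - s * num z) ∧
      den (newComponent x y z) = e' * (den y - s * den z) := by
  have key : ∀ s : ℤ, IsCoprime (num y + s * num z) (den y + s * den z) := by
    intro s
    rcases (neighbors_iff y z).mp hyz with h | h
    · exact ⟨den z, -num z, by linear_combination h⟩
    · exact ⟨-den z, num z, by linear_combination -h⟩
  have hsum : ∃ e : ℤ, (e = 1 ∨ e = -1) ∧ num (fareySum y z) = e * (num y + num z) ∧
      den (fareySum y z) = e * (den y + den z) := by
    simpa [fareySum] using frac_of_isCoprime (key 1)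
  have hdiff : ∃ e : ℤ, (e = 1 ∨ e = -1) ∧ num (fareyDiff y z) = e * (num y - num z) ∧
      den (fareyDiff y z) = e * (den y - den z) := by
    simpa [fareyDiff, ← sub_eq_add_neg] using frac_of_isCoprime (key (-1))
  obtain ⟨e₁, he₁, hs₁, hs₂⟩ := hsum
  obtain ⟨e₂, he₂, hd₁, hd₂⟩ := hdiff
  simp only [newComponent, lt_iff_num_mul_den_lt]
  rw [neighbors_iff] at hyz hxy hxz
  -- `x = u y + v z` by Cramer's rule
  set D := num y * den z - num z * den y with hD
  have hDD : D * D = 1 := by rcases hyz with h | h <;> rw [h] <;> rfl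
  set v := num x * den y - num y * den x with hv
  set u := num x * den z - num z * den x with hu
  have hn : num x = D * (u * num y - v * num z) := by
    rw [hu, hv]; linear_combination (-num x) * hDD + num x * D * hD
  have hd : den x = D * (u * den y - v * den z) := by
    rw [hu, hv]; linear_combination (-den x) * hDD + den x * D * hD
  -- `x` lies between `y` and `z` exactly when its determinants with `y` and with `z` have opposite
  -- signs.
  rcases hxy with h1 | h1 <;> rcases hxz with h2 | h2
  · rw [if_neg (by omega)]
    refine ⟨D, e₁, -1, hyz, he₁, Or.inr rfl, ?_, ?_, ?_, ?_⟩
    · rw [hn, h1, h2]; ring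
    · rw [hd, h1, h2]; ring
    · rw [hs₁]; ring
    · rw [hs₂]; ring
  · rw [if_pos (by omega)]
    refine ⟨-D, e₂, 1, by omega, he₂, Or.inl rfl, ?_, ?_, ?_, ?_⟩
    · rw [hn, h1, h2]; ring
    · rw [hd, h1, h2]; ring
    · rw [hd₁]; ring
    · rw [hd₂]; ring
  · rw [if_pos (by omega)]
    refine ⟨D, e₂, 1, hyz, he₂, Or.inl rfl, ?_, ?_, ?_, ?_⟩
    · rw [hn, h1, h2]; ring
    · rw [hd, h1, h2]; ring
    · rw [hd₁]; ring
    · rw [hd₂]; ring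
  · rw [if_neg (by omega)]
    refine ⟨-D, e₁, -1, by omega, he₁, Or.inr rfl, ?_, ?_, ?_, ?_⟩
    · rw [hn, h1, h2]; ring
    · rw [hd, h1, h2]; ring
    · rw [hs₁]; ring
    · rw [hs₂]; ring

/-! ### Mutation of Farey triples -/

namespace FareyTriple

theorem mutate_q_self (T : FareyTriple) (k : Fin 3) :
    (T.mutate k).q k = newComponent (T.q k) (T.q (k + 1)) (T.q (k + 2)) :=
  Function.update_self ..

theorem mutate_q_of_ne (T : FareyTriple) {j k : Fin 3} (h : j ≠ k) : (T.mutate k).q j = T.q j :=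
  Function.update_of_ne h ..

theorem mutate_q_add_one (T : FareyTriple) (k : Fin 3) : (T.mutate k).q (k + 1) = T.q (k + 1) :=
  T.mutate_q_of_ne (by simp)

theorem mutate_q_add_two (T : FareyTriple) (k : Fin 3) : (T.mutate k).q (k + 2) = T.q (k + 2) :=
  T.mutate_q_of_ne (by simp)

theorem mutate_spec (T : FareyTriple) (k : Fin 3) :
    ∃ e e' s : ℤ, (e = 1 ∨ e = -1) ∧ (e' = 1 ∨ e' = -1) ∧ (s = 1 ∨ s = -1) ∧
      num (T.q k) = e * (num (T.q (k + 1)) + s * num (T.q (k + 2))) ∧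
      den (T.q k) = e * (den (T.q (k + 1)) + s * den (T.q (k + 2))) ∧
      num ((T.mutate k).q k) = e' * (num (T.q (k + 1)) - s * num (T.q (k + 2))) ∧
      den ((T.mutate k).q k) = e' * (den (T.q (k + 1)) - s * den (T.q (k + 2))) := by
  rw [mutate_q_self]
  exact newComponent_of_neighbors (T.neighbors _ _ (by simp)) (T.neighbors _ _ (by simp))
    (T.neighbors _ _ (by simp))

theorem forall_fin_three_of_cyclic {P : Fin 3 → Prop} (k : Fin 3) (h0 : P k) (h1 : P (k + 1))
    (h2 : P (k + 2)) (j : Fin 3) : P j := by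
  rcases (by decide : ∀ k j : Fin 3, j = k ∨ j = k + 1 ∨ j = k + 2) k j with rfl | rfl | rfl
  exacts [h0, h1, h2]

theorem mutate_mutate (T : FareyTriple) (k : Fin 3) : (T.mutate k).mutate k = T := by
  obtain ⟨e, e', s, he, he', hs, hn, hd, hn', hd'⟩ := T.mutate_spec k
  obtain ⟨f, f', t, hf, hf', ht, kn, kd, kn', kd'⟩ := (T.mutate k).mutate_spec k
  rw [mutate_q_add_one, mutate_q_add_two] at kn kd kn' kd'
  ext1
  funext j
  refine forall_fin_three_of_cyclic (P := fun j => ((T.mutate k).mutate k).q j = T.q j) k ?_ ?_ ?_ j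
  · have hnb := (neighbors_iff _ _).mp (T.neighbors (k + 1) (k + 2) (by simp))
    -- The vectors `y` and `z` are linearly independent, so `y - s z = ±(y + t z)` determines `t`.
    -- The second mutation then restores `y + s z` up to sign.
    have hst : t = -s := by
      rw [hn'] at kn
      rw [hd'] at kd
      generalize num (T.q (k + 1)) = a at *
      generalize num (T.q (k + 2)) = b at *
      generalize den (T.q (k + 1)) = c at *
      generalize den (T.q (k + 2)) = d at *
      by_contra hts
      obtain rfl : t = s := by omega
      have h1 : e' * (a * d - b * c) = f * (a * d - b * c) := by
        linear_combination d * kn - b * kd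
      have h2 : -(e' * t * (a * d - b * c)) = f * t * (a * d - b * c) := by
        linear_combination a * kd - c * kn
      rcases hnb with h | h <;> rw [h] at h1 h2 <;> rcases ht with rfl | rfl <;> omega
    subst hst
    refine ext_of_num_den_smul (e := f' * e) ?_ ?_ ?_
    · rcases he with rfl | rfl <;> rcases hf' with rfl | rfl <;> simp
    · have hee : e * e = 1 := by rcases he with rfl | rfl <;> rfl
      rw [kn', hn]; linear_combination -f' * (num (T.q (k + 1)) + s * num (T.q (k + 2))) * hee
    · have hee : e * e = 1 := by rcases he with rfl | rfl <;> rfl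
      rw [kd', hd]; linear_combination -f' * (den (T.q (k + 1)) + s * den (T.q (k + 2))) * hee
  · rw [mutate_q_add_one, mutate_q_add_one]
  · rw [mutate_q_add_two, mutate_q_add_two]

/-! ### Reduced words never return to the initial triple -/

/-- The value of the form `a² + ab + b²` at a reduced fraction `a / b`. -/
def _root_.Farey.size (q : ExtRat) : ℤ := num q ^ 2 + num q * den q + den q ^ 2

/-- The total size of the components of a Farey triple. -/
def height (T : FareyTriple) : ℤ := size (T.q 0) + size (T.q 1) + size (T.q 2)

theorem height_eq (T : FareyTriple) (k : Fin 3) :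
    T.height = size (T.q k) + size (T.q (k + 1)) + size (T.q (k + 2)) := by
  fin_cases k <;> simp [height] <;> ring

theorem height_mutate_sub (T : FareyTriple) (k : Fin 3) :
    (T.mutate k).height - T.height = size ((T.mutate k).q k) - size (T.q k) := by
  rw [height_eq _ k, height_eq T k, mutate_q_add_one, mutate_q_add_two]
  ring

theorem size_pos (q : ExtRat) : 0 < size q := by
  have h : num q ≠ 0 ∨ den q ≠ 0 := by
    cases q using WithTop.recTopCoe with
    | top => exact Or.inl one_ne_zero
    | coe q => exact Or.inr (Int.natCast_ne_zero.mpr q.den_nz)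
  unfold size
  rcases h with h | h
  · have := sq_pos_of_ne_zero h
    nlinarith [sq_nonneg (num q + 2 * den q)]
  · have := sq_pos_of_ne_zero h
    nlinarith [sq_nonneg (2 * num q + den q)]

/-- The sign by which `y = f (z + t x)` if `x = e (y + s z)`. -/
theorem _root_.Farey.sign_of_relation {a b c d e s f t : ℤ}
    (hD : a * d - b * c = 1 ∨ a * d - b * c = -1)
    (he : e = 1 ∨ e = -1) (hs : s = 1 ∨ s = -1) (hf : f = 1 ∨ f = -1)
    (h1 : a = f * (b + t * (e * (a + s * b)))) (h2 : c = f * (d + t * (e * (c + s * d)))) :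
    t = -(e * s) := by
  -- The coefficient of the second vector `(b, d)` must vanish; the determinant isolates it.
  have h : f * (1 + t * (e * s)) * (a * d - b * c) = 0 := by
    linear_combination c * h1 - a * h2
  have hD0 : a * d - b * c ≠ 0 := by omega
  have hf0 : f ≠ 0 := by omega
  have h := ((mul_eq_zero.mp ((mul_eq_zero.mp h).resolve_right hD0))).resolve_left hf0
  rcases he with rfl | rfl <;> rcases hs with rfl | rfl <;> omega

/-- A mutation in a direction different from a height-decreasing one increases the height. -/
theorem height_lt_mutate {T : FareyTriple} {k j : Fin 3} (hkj : j ≠ k)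
    (h : (T.mutate k).height < T.height) : T.height < (T.mutate j).height := by
  have h1 := T.height_mutate_sub k
  have h2 := T.height_mutate_sub j
  suffices hs : size (T.q j) < size ((T.mutate j).q j) by omega
  have h3 : size ((T.mutate k).q k) < size (T.q k) := by omega
  clear h h1 h2
  obtain ⟨e, e', s, he, he', hs, hn, hd, hn', hd'⟩ := T.mutate_spec k
  obtain ⟨f, f', t, hf, hf', ht, kn, kd, kn', kd'⟩ := T.mutate_spec j
  have hp1 := size_pos (T.q (k + 1))
  have hp2 := size_pos (T.q (k + 2))
  have hnb := (neighbors_iff _ _).mp (T.neighbors (k + 1) (k + 2) (by simp))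
  have hs2 : s * s = 1 := by rcases hs with rfl | rfl <;> rfl
  -- Let `β` be the polar form of `size`. The decrease at `k` says `size (y + s z) - size (y - s z)
  -- = 2 s β(y, z) > 0`. Mutating `y` gives `±(s y + 2 z)`, of size `size y + 2 s β(y, z) + 4 size z
  -- > size y`; the case of `z` is symmetric.
  rcases (by decide : ∀ k j : Fin 3, j ≠ k → j = k + 1 ∨ j = k + 2) k j hkj with rfl | rfl
  · rw [show k + 1 + 1 = k + 2 from add_assoc k 1 1,
      show k + 1 + 2 = k from (add_assoc k 1 2).trans (add_zero k)] at kn kd kn' kd'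
    rw [hn] at kn kn'
    rw [hd] at kd kd'
    unfold size at *
    rw [kn', kd']
    rw [hn, hd, hn', hd'] at h3
    generalize num (T.q (k + 1)) = a at *
    generalize num (T.q (k + 2)) = b at *
    generalize den (T.q (k + 1)) = c at *
    generalize den (T.q (k + 2)) = d at *
    obtain rfl := sign_of_relation hnb he hs hf kn kd
    clear kn kd kn' kd' hn hd hn' hd' hnb
    rcases he with rfl | rfl <;> rcases hs with rfl | rfl <;> rcases he' with rfl | rfl <;>
      rcases hf' with rfl | rfl <;> nlinarith
  · rw [show k + 2 + 1 = k from (add_assoc k 2 1).trans (add_zero k),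
      show k + 2 + 2 = k + 1 from add_assoc k 2 2] at kn kd kn' kd'
    rw [hn] at kn kn'
    rw [hd] at kd kd'
    unfold size at *
    rw [kn', kd']
    rw [hn, hd, hn', hd'] at h3
    generalize num (T.q (k + 1)) = a at *
    generalize num (T.q (k + 2)) = b at *
    generalize den (T.q (k + 1)) = c at *
    generalize den (T.q (k + 2)) = d at *
    obtain rfl : t = -e := by
      -- The roles of `y` and `z` are exchanged: `e (y + s z) = e s (z + s y)`, and `x + t y = t (y
      -- + t x)` since `t² = 1`.
      have := sign_of_relation (a := b) (b := a) (c := d) (d := c) (e := e * s) (s := s)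
        (f := f * t) (t := t) (by omega)
        (by rcases he with rfl | rfl <;> rcases hs with rfl | rfl <;> simp) hs
        (by rcases hf with rfl | rfl <;> rcases ht with rfl | rfl <;> simp)
        (by rcases ht with rfl | rfl <;> rcases hs with rfl | rfl <;> linarith)
        (by rcases ht with rfl | rfl <;> rcases hs with rfl | rfl <;> linarith)
      rw [this, mul_assoc, hs2, mul_one]
    clear kn kd kn' kd' hn hd hn' hd' hnb
    rcases he with rfl | rfl <;> rcases hs with rfl | rfl <;> rcases he' with rfl | rfl <;>
      rcases hf' with rfl | rfl <;> nlinarith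

/-- All initial components have size 1, and each mutation introduces one of size 3. -/
theorem height_initial_lt (k : Fin 3) : initial.height < (initial.mutate k).height := by
  rw [← sub_pos, height_mutate_sub]
  obtain ⟨e, e', s, he, he', hs, hn, hd, hn', hd'⟩ := initial.mutate_spec k
  have h0 : num (initial.q 0) = 0 ∧ den (initial.q 0) = 1 := ⟨rfl, rfl⟩
  have h1 : num (initial.q 1) = -1 ∧ den (initial.q 1) = 1 := ⟨rfl, rfl⟩
  have h2 : num (initial.q 2) = 1 ∧ den (initial.q 2) = 0 := ⟨rfl, rfl⟩
  rw [size, hn', hd', size]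
  fin_cases k <;> simp [h0, h1, h2] at hn hd ⊢ <;>
    rcases he with rfl | rfl <;> rcases hs with rfl | rfl <;> rcases he' with rfl | rfl <;>
    revert hn hd <;> norm_num

theorem mutateWord_append_singleton (T : FareyTriple) (w : List (Fin 3)) (k : Fin 3) :
    T.mutateWord (w ++ [k]) = (T.mutateWord w).mutate k := by
  simp [mutateWord]

/-- The last step of a reduced word raises the height of the triple. -/
theorem height_mutateWord_lt (w : List (Fin 3)) (k : Fin 3)
    (h : (w ++ [k]).IsChain (· ≠ ·)) :
    initial.height ≤ (initial.mutateWord w).height ∧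
    (initial.mutateWord w).height < (initial.mutateWord (w ++ [k])).height := by
  induction w using List.reverseRecOn generalizing k with
  | nil => exact ⟨le_rfl, height_initial_lt k⟩
  | append_singleton w j ih =>
    have hw : (w ++ [j]).IsChain (· ≠ ·) := h.left_of_append
    have hjk : k ≠ j := by
      rw [List.append_assoc] at h
      have := h.right_of_append
      simp at this
      exact Ne.symm this
    have := ih j hw
    refine ⟨by omega, ?_⟩
    rw [mutateWord_append_singleton _ (w ++ [j])]
    refine height_lt_mutate hjk ?_
    rw [mutateWord_append_singleton _ w, mutate_mutate, ← mutateWord_append_singleton _ w]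
    exact this.2

theorem mutateWord_ne_initial {w : List (Fin 3)} (hw : w ≠ []) (h : w.IsChain (· ≠ ·)) :
    initial.mutateWord w ≠ initial := by
  obtain ⟨w, k, rfl⟩ := List.eq_nil_or_concat' w |>.resolve_left hw
  intro h0
  have := height_mutateWord_lt w k h
  rw [h0] at this
  omega

/-! ### The nonnegative Farey triples -/

/-- All components of the triple lie in `[0, ∞]`. -/
def IsNonneg (T : FareyTriple) : Prop := ∀ j, 0 ≤ num (T.q j)

/-- Nonnegative vectors `(a, c)` and `(b, d)` of determinant `±1` whose difference has entries of
opposite signs are the two unit vectors. -/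
theorem _root_.Farey.unit_vectors_of_mixed_signs {a b c d : ℤ} (ha : 0 ≤ a) (hb : 0 ≤ b)
    (hd : 0 ≤ d) (hD : a * d - b * c = 1 ∨ a * d - b * c = -1)
    (h : a < b) (h' : d < c) : a = 0 ∧ b = 1 ∧ c = 1 ∧ d = 0 := by
  -- Expanding gives `a + d + 1 ≤ b c - a d ≤ 1`.
  have h1 : (a + 1) * (d + 1) ≤ b * c := mul_le_mul (by omega) (by omega) (by omega) (by omega)
  have h2 : a + d = 0 := by rcases hD with hD | hD <;> nlinarith
  obtain rfl : a = 0 := by omega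
  obtain rfl : d = 0 := by omega
  have h3 : b * c = 1 := by omega
  have := Int.eq_one_or_neg_one_of_mul_eq_one h3
  obtain rfl : b = 1 := by omega
  omega

/-- Parity fixes the position of each of the three components. -/
theorem eq_initial_of_unit_vectors {T : FareyTriple} {i j k : Fin 3}
    (hij : i ≠ j) (hik : i ≠ k) (hjk : j ≠ k)
    (hi : num (T.q i) = 0 ∧ den (T.q i) = 1) (hj : num (T.q j) = 1 ∧ den (T.q j) = 0)
    (hk : num (T.q k) = -1 ∧ den (T.q k) = 1) : T = initial ∧ k = 1 := by
  have pi := T.parity i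
  have pj := T.parity j
  have h0 : i = 0 := by
    generalize T.q i = x at hi pi
    fin_cases i <;> simp [HasParity, hi] at pi ⊢
  have h2 : j = 2 := by
    generalize T.q j = x at hj pj
    fin_cases j <;> simp [HasParity, hj] at pj ⊢
  subst h0 h2
  obtain rfl : k = 1 := by omega
  refine ⟨?_, rfl⟩
  ext1
  funext m
  refine forall_fin_three_of_cyclic (P := fun m => T.q m = initial.q m) 0
    (ext_of_num_den hi.1 hi.2) (ext_of_num_den hk.1 hk.2) (ext_of_num_den hj.1 hj.2) m

/-- A negative new component must be a difference of nonnegative vectors with entries of opposite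
signs. This happens only for `0/1` and `1/0`, and the new component is then `-1/1`. -/
theorem eq_initial_of_mutate_not_isNonneg {T : FareyTriple} (hT : T.IsNonneg) {k : Fin 3}
    (h : ¬ (T.mutate k).IsNonneg) : T.mutate k = initial ∧ k = 1 := by
  have hneg : num ((T.mutate k).q k) < 0 := by
    by_contra hk
    refine h fun j => ?_
    by_cases hj : j = k
    · subst hj; omega
    · rw [mutate_q_of_ne _ hj]; exact hT j
  obtain ⟨e, e', s, he, he', hs, hn, hd, hn', hd'⟩ := T.mutate_spec k
  have hnb := (neighbors_iff _ _).mp (T.neighbors (k + 1) (k + 2) (by simp))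
  have hY := hT (k + 1)
  have hZ := hT (k + 2)
  have hY' := den_nonneg (T.q (k + 1))
  have hZ' := den_nonneg (T.q (k + 2))
  have hpos : 0 < den ((T.mutate k).q k) := by
    refine lt_of_le_of_ne (den_nonneg _) fun h0 => ?_
    rw [eq_top_of_den_eq_zero h0.symm] at hneg
    exact absurd hneg (by decide)
  have := @eq_initial_of_unit_vectors (T.mutate k)
  rw [hn'] at hneg
  rw [hd'] at hpos
  rcases hs with rfl | rfl
  · rcases he' with rfl | rfl
    · obtain ⟨h1, h2, h3, h4⟩ := unit_vectors_of_mixed_signs hY hZ hZ' hnb (by omega) (by omega)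
      refine this (i := k + 1) (j := k + 2) (k := k) (by simp) (by simp) (by simp) ?_ ?_ ?_
      · rw [mutate_q_add_one]; exact ⟨h1, h3⟩
      · rw [mutate_q_add_two]; exact ⟨h2, h4⟩
      · omega
    · obtain ⟨h1, h2, h3, h4⟩ := unit_vectors_of_mixed_signs hZ hY hY'
        (c := den (T.q (k + 2))) (by omega) (by omega) (by omega)
      refine this (i := k + 2) (j := k + 1) (k := k) (by simp) (by simp) (by simp) ?_ ?_ ?_
      · rw [mutate_q_add_two]; exact ⟨h1, h3⟩
      · rw [mutate_q_add_one]; exact ⟨h2, h4⟩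
      · omega
  · rcases he' with rfl | rfl <;> omega

theorem eq_initial_of_mutate_isNonneg {T : FareyTriple} (hT : ¬ T.IsNonneg) {k : Fin 3}
    (h : (T.mutate k).IsNonneg) : T = initial ∧ k = 1 := by
  have := eq_initial_of_mutate_not_isNonneg h (k := k) (by rwa [mutate_mutate])
  rwa [mutate_mutate] at this

theorem initial_mutate_one_q_one :
    num ((initial.mutate 1).q 1) = 1 ∧ den ((initial.mutate 1).q 1) = 1 := by
  obtain ⟨e, e', s, he, he', hs, hn, hd, hn', hd'⟩ := initial.mutate_spec 1
  have h0 : num (initial.q (1 + 2)) = 0 ∧ den (initial.q (1 + 2)) = 1 := ⟨rfl, rfl⟩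
  have h1 : num (initial.q 1) = -1 ∧ den (initial.q 1) = 1 := ⟨rfl, rfl⟩
  have h2 : num (initial.q (1 + 1)) = 1 ∧ den (initial.q (1 + 1)) = 0 := ⟨rfl, rfl⟩
  have := den_nonneg ((initial.mutate 1).q 1)
  rw [h0.1, h1.1, h2.1] at hn
  rw [h0.2, h1.2, h2.2] at hd
  rw [h0.1, h2.1] at hn'
  rw [h0.2, h2.2] at hd'
  rcases he with rfl | rfl <;> rcases hs with rfl | rfl <;> rcases he' with rfl | rfl <;> omega

theorem initial_mutate_isNonneg_iff (k : Fin 3) : (initial.mutate k).IsNonneg ↔ k = 1 := by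
  constructor
  · intro h
    by_contra hk
    have := h 1
    rw [mutate_q_of_ne _ (Ne.symm hk)] at this
    exact absurd this (by decide)
  · rintro rfl j
    refine forall_fin_three_of_cyclic (P := fun j => 0 ≤ num ((initial.mutate 1).q j)) 1 ?_ ?_ ?_ j
    · rw [initial_mutate_one_q_one.1]; exact zero_le_one
    · rw [mutate_q_add_one]; decide
    · rw [mutate_q_add_two]; decide

theorem not_isNonneg_initial : ¬ initial.IsNonneg := fun h => by
  have := h 1
  have h1 : num (initial.q 1) = -1 := rfl
  omega

/-- Every edge leaving the nonnegative triples ends at the initial triple, which paths in the branch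
avoid. -/
theorem isNonneg_of_mem_branch {T : FareyTriple} (h : T ∈ branch 1) : T.IsNonneg := by
  obtain ⟨hS, hT, ⟨p⟩⟩ := h
  suffices H : ∀ (U V : {U : FareyTriple | U ≠ initial})
      (_ : (exchangeGraph.induce {U | U ≠ initial}).Walk U V), U.1.IsNonneg → V.1.IsNonneg from
    H _ _ p ((initial_mutate_isNonneg_iff 1).mpr rfl)
  intro U V p
  induction p with
  | nil => exact id
  | @cons U V W hadj _ ih =>
    intro hU
    refine ih ?_
    by_contra hV
    rw [SimpleGraph.comap_adj] at hadj
    rcases ((SimpleGraph.fromRel_adj _ _ _).mp hadj).2 with ⟨k, hk⟩ | ⟨k, hk⟩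
    · change V.1 = U.1.mutate k at hk
      rw [hk] at hV
      exact V.2 (hk.trans (eq_initial_of_mutate_not_isNonneg hU hV).1)
    · change U.1 = V.1.mutate k at hk
      rw [hk] at hU
      exact V.2 (eq_initial_of_mutate_isNonneg hV hU).1

/-- Every triple of a branch is reached from the initial triple by a word. -/
theorem exists_mutateWord_of_mem_branch {T : FareyTriple} {i : Fin 3} (h : T ∈ branch i) :
    ∃ w, initial.mutateWord w = T := by
  obtain ⟨hS, hT, ⟨p⟩⟩ := h
  suffices H : ∀ (U V : {U : FareyTriple | U ≠ initial})
      (_ : (exchangeGraph.induce {U | U ≠ initial}).Walk U V),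
      (∃ w, initial.mutateWord w = U.1) → ∃ w, initial.mutateWord w = V.1 from
    H _ _ p ⟨[i], rfl⟩
  intro U V p
  induction p with
  | nil => exact id
  | @cons U V W hadj _ ih =>
    rintro ⟨w, hw⟩
    refine ih ?_
    rw [SimpleGraph.comap_adj] at hadj
    rcases ((SimpleGraph.fromRel_adj _ _ _).mp hadj).2 with ⟨k, hk⟩ | ⟨k, hk⟩
    · exact ⟨w ++ [k], by rw [mutateWord_append_singleton, hw]; exact hk.symm⟩
    · refine ⟨w ++ [k], ?_⟩
      rw [mutateWord_append_singleton, hw]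
      change U.1 = V.1.mutate k at hk
      rw [hk, mutate_mutate]

end FareyTriple

end Farey

namespace Farey

/-! ### The normalization `∞ = -1/0` -/

/-- The numerator of the reduced fraction, with `∞ = -1/0`. -/
def lowNum (q : ExtRat) : ℤ := if q = ⊤ then -1 else num q

theorem exists_sign_lowNum (q : ExtRat) :
    ∃ e : ℤ, (e = 1 ∨ e = -1) ∧ num q = e * lowNum q ∧ den q = e * den q := by
  by_cases h : q = ⊤
  · subst h; exact ⟨-1, Or.inr rfl, by simp [lowNum, num], by simp [den]⟩
  · exact ⟨1, Or.inl rfl, by simp [lowNum, h], by simp⟩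

theorem lowNum_den_of_num_nonneg {q : ExtRat} (h : 0 ≤ num q) :
    (0 ≤ lowNum q ∧ 1 ≤ den q) ∨ (lowNum q = -1 ∧ den q = 0) := by
  by_cases hq : q = ⊤
  · subst hq; exact Or.inr ⟨by simp [lowNum], rfl⟩
  · have h0 : den q ≠ 0 := fun h => hq (eq_top_of_den_eq_zero h)
    have h1 := den_nonneg q
    exact Or.inl ⟨by simpa [lowNum, hq] using h, by omega⟩

/-- If `(a, c)`, `(b, d)` and `δ ((b, d) - (a, c))` all represent elements of `[0, ∞]`, where
`∞ = -1/0`, then the following three integers are nonnegative. -/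
theorem sign_coherence {a b c d δ D p r : ℤ} (hδ : δ = 1 ∨ δ = -1)
    (hD : D = a * d - b * c) (hD1 : D = 1 ∨ D = -1) (hp : p = δ * (b - a)) (hr : r = δ * (d - c))
    (hY : (0 ≤ a ∧ 1 ≤ c) ∨ (a = -1 ∧ c = 0)) (hZ : (0 ≤ b ∧ 1 ≤ d) ∨ (b = -1 ∧ d = 0))
    (hO : (0 ≤ p ∧ 1 ≤ r) ∨ (p = -1 ∧ r = 0)) :
    0 ≤ p + δ * D ∧ 0 ≤ p + r + δ * D ∧ 0 ≤ r + δ * D := by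
  have h1 : δ * D = a * r - p * c := by rw [hD, hp, hr]; ring
  have h2 : δ * D = b * r - p * d := by rw [hD, hp, hr]; ring
  have h3 : δ * D = 1 ∨ δ * D = -1 := by
    rcases hδ with rfl | rfl <;> rcases hD1 with h | h <;> simp [h]
  rcases h3 with h | h
  · omega
  · rcases hO with ⟨hp0, hr1⟩ | ⟨hp1, hr0⟩
    -- With `p = 0` one gets `a r = b r = -1`, so both vectors would be `(-1, 0)`, contradicting `D
    -- = ±1`.
    · have : p ≠ 0 := by
        intro hp0
        rw [h, hp0] at h1 h2
        have ha : a = -1 := by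
          rcases hY with hY | hY
          · nlinarith
          · exact hY.1
        have hb : b = -1 := by
          rcases hZ with hZ | hZ
          · nlinarith
          · exact hZ.1
        have hc : c = 0 := by omega
        have hd : d = 0 := by omega
        rw [ha, hb, hc, hd] at hD
        omega
      omega
    · rw [h, hp1, hr0] at h1
      omega

end Farey

/-! ### Closed formulas for the g- and c-vectors and their mutation rules. -/

namespace Markov

open Farey Cluster FareyTriple

/-- The determinant of two components of a Farey triple, normalized by `∞ = -1/0`. -/
def lowDet (T : FareyTriple) (i j : Fin 3) : ℤ :=
  lowNum (T.q i) * den (T.q j) - lowNum (T.q j) * den (T.q i)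

/-- The negative of the cyclic orientation of the components of a Farey triple. -/
def orientation (T : FareyTriple) : ℤ := -(lowDet T 0 1 * lowDet T 1 2 * lowDet T 2 0)

/-- The g-vector attached to a component of a Farey triple. -/
def gVec (T : FareyTriple) (k : Fin 3) : Fin 3 → ℤ :=
  ![lowNum (T.q k) + 1, den (T.q k) - lowNum (T.q k) - 1, 1 - den (T.q k)]

/-- The c-vector attached to a position in a Farey triple whose other two components are
`y = (a, c)` and `z = (b, d)`. -/
def cVecAux (a b c d D : ℤ) : Fin 3 → ℤ := ![b - a + D, b - a + (d - c) + D, d - c + D]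

/-- The c-vector attached to a position in a Farey triple. -/
def cVec (T : FareyTriple) (k : Fin 3) (m : Fin 3) : ℤ :=
  orientation T * cVecAux (lowNum (T.q (k + 1))) (lowNum (T.q (k + 2))) (den (T.q (k + 1)))
    (den (T.q (k + 2))) (lowDet T (k + 1) (k + 2)) m

theorem orientation_eq (T : FareyTriple) (k : Fin 3) :
    orientation T = -(lowDet T k (k + 1) * lowDet T (k + 1) (k + 2) * lowDet T (k + 2) k) := by
  fin_cases k <;> simp [orientation] <;> ring

theorem lowDet_eq_one_or (T : FareyTriple) {i j : Fin 3} (h : i ≠ j) :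
    lowDet T i j = 1 ∨ lowDet T i j = -1 := by
  have hn := (neighbors_iff _ _).mp (T.neighbors i j h)
  obtain ⟨e, he, h1, h2⟩ := exists_sign_lowNum (T.q i)
  obtain ⟨f, hf, h3, h4⟩ := exists_sign_lowNum (T.q j)
  have : num (T.q i) * den (T.q j) - num (T.q j) * den (T.q i) = e * f * lowDet T i j := by
    rw [lowDet, h1, h3]
    linear_combination e * lowNum (T.q i) * h4 - f * lowNum (T.q j) * h2
  rw [this] at hn
  rcases he with rfl | rfl <;> rcases hf with rfl | rfl <;> omega

theorem orientation_eq_one_or (T : FareyTriple) : orientation T = 1 ∨ orientation T = -1 := by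
  rw [orientation]
  rcases lowDet_eq_one_or T (i := 0) (j := 1) (by decide) with hx | hx <;>
  rcases lowDet_eq_one_or T (i := 1) (j := 2) (by decide) with hy | hy <;>
  rcases lowDet_eq_one_or T (i := 2) (j := 0) (by decide) with hz | hz <;>
  simp [hx, hy, hz]

/-- Of a component and its mutation, one is the sum and the other the difference
of the remaining components. -/
theorem lowNum_den_mutate (T : FareyTriple) (k : Fin 3) :
    ∃ δ : ℤ, (δ = 1 ∨ δ = -1) ∧
      ((lowNum (T.q k) = lowNum (T.q (k + 1)) + lowNum (T.q (k + 2)) ∧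
        den (T.q k) = den (T.q (k + 1)) + den (T.q (k + 2)) ∧
        lowNum ((T.mutate k).q k) = δ * (lowNum (T.q (k + 2)) - lowNum (T.q (k + 1))) ∧
        den ((T.mutate k).q k) = δ * (den (T.q (k + 2)) - den (T.q (k + 1)))) ∨
       (lowNum ((T.mutate k).q k) = lowNum (T.q (k + 1)) + lowNum (T.q (k + 2)) ∧
        den ((T.mutate k).q k) = den (T.q (k + 1)) + den (T.q (k + 2)) ∧
        lowNum (T.q k) = δ * (lowNum (T.q (k + 2)) - lowNum (T.q (k + 1))) ∧
        den (T.q k) = δ * (den (T.q (k + 2)) - den (T.q (k + 1))))) := by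
  obtain ⟨e, e', s, he, he', hs, hn, hd, hn', hd'⟩ := T.mutate_spec k
  obtain ⟨u, hu, hu1, hu2⟩ := exists_sign_lowNum (T.q k)
  obtain ⟨u', hu', hu1', hu2'⟩ := exists_sign_lowNum ((T.mutate k).q k)
  obtain ⟨v, hv, hv1, hv2⟩ := exists_sign_lowNum (T.q (k + 1))
  obtain ⟨w, hw, hw1, hw2⟩ := exists_sign_lowNum (T.q (k + 2))
  have hD := lowDet_eq_one_or T (i := k + 1) (j := k + 2) (by simp)
  have p0 := den_nonneg (T.q k)
  have p0' := den_nonneg ((T.mutate k).q k)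
  have p1 := den_nonneg (T.q (k + 1))
  have p2 := den_nonneg (T.q (k + 2))
  have hsum : den (T.q (k + 1)) + den (T.q (k + 2)) ≠ 0 := by
    intro h0
    rw [lowDet, show den (T.q (k + 1)) = 0 by omega, show den (T.q (k + 2)) = 0 by omega] at hD
    omega
  rw [hu1, hv1, hw1] at hn
  rw [hu1', hv1, hw1] at hn'
  generalize lowNum (T.q k) = x at *
  generalize den (T.q k) = y at *
  generalize lowNum ((T.mutate k).q k) = x' at *
  generalize den ((T.mutate k).q k) = y' at *
  generalize lowNum (T.q (k + 1)) = a at *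
  generalize den (T.q (k + 1)) = c at *
  generalize lowNum (T.q (k + 2)) = b at *
  generalize den (T.q (k + 2)) = d at *
  clear hu1 hu1' hv1 hw1 hD
  obtain ⟨t, t', r, ht, ht', hr, h1, h2, h3, h4⟩ : ∃ t t' r : ℤ, (t = 1 ∨ t = -1) ∧
      (t' = 1 ∨ t' = -1) ∧ (r = 1 ∨ r = -1) ∧ x = t * (a + r * b) ∧ y = t * (c + r * d) ∧
      x' = t' * (a - r * b) ∧ y' = t' * (c - r * d) := by
    refine ⟨u * e * v, u' * e' * v, v * s * w, ?_, ?_, ?_, ?_, ?_, ?_, ?_⟩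
    · rcases hu with rfl | rfl <;> rcases he with rfl | rfl <;> rcases hv with rfl | rfl <;> simp
    · rcases hu' with rfl | rfl <;> rcases he' with rfl | rfl <;> rcases hv with rfl | rfl <;> simp
    · rcases hw with rfl | rfl <;> rcases hs with rfl | rfl <;> rcases hv with rfl | rfl <;> simp
    · rcases hu with rfl | rfl <;> rcases hv with rfl | rfl <;> linarith
    · rcases hu with rfl | rfl <;> rcases hv with rfl | rfl <;> rcases hw with rfl | rfl <;>
        rcases he with rfl | rfl <;> rcases hs with rfl | rfl <;> omega
    · rcases hu' with rfl | rfl <;> rcases hv with rfl | rfl <;> linarith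
    · rcases hu' with rfl | rfl <;> rcases hv with rfl | rfl <;> rcases hw with rfl | rfl <;>
        rcases he' with rfl | rfl <;> rcases hs with rfl | rfl <;> omega
  clear hn hd hn' hd'
  -- Denominators are nonnegative and the sum `c + d` is nonzero, so the sum occurs with sign `+1`.
  -- Only the difference keeps an unknown sign `δ`.
  rcases hr with rfl | rfl
  · obtain rfl : t = 1 := by rcases ht with rfl | rfl <;> omega
    refine ⟨-t', by omega, Or.inl ⟨by omega, by omega, ?_, ?_⟩⟩
    · rw [h3]; ring
    · rw [h4]; ring
  · obtain rfl : t' = 1 := by rcases ht' with rfl | rfl <;> omega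
    refine ⟨-t, by omega, Or.inr ⟨by omega, by omega, ?_, ?_⟩⟩
    · rw [h1]; ring
    · rw [h2]; ring

/-- The effect of a mutation inside `[0, ∞]` on the attached g-vectors and c-vectors. -/
theorem exists_sign_mutate {T : FareyTriple} {k : Fin 3} (hT' : (T.mutate k).IsNonneg)
    (hT : T.IsNonneg ∨ (lowNum (T.q k) = lowNum (T.q (k + 1)) + lowNum (T.q (k + 2)) ∧
        den (T.q k) = den (T.q (k + 1)) + den (T.q (k + 2)))) :
    ∃ δ : ℤ, (δ = 1 ∨ δ = -1) ∧ orientation (T.mutate k) = -orientation T ∧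
      (∀ m, gVec (T.mutate k) k m
        = (1 - δ) * gVec T (k + 1) m + (1 + δ) * gVec T (k + 2) m - gVec T k m) ∧
      (∀ m, cVec (T.mutate k) k m = -cVec T k m) ∧
      (∀ m, cVec (T.mutate k) (k + 1) m = cVec T (k + 1) m + (1 - δ) * cVec T k m) ∧
      (∀ m, cVec (T.mutate k) (k + 2) m = cVec T (k + 2) m + (1 + δ) * cVec T k m) ∧
      ∀ m, 0 ≤ orientation T * δ * cVec T k m := by
  obtain ⟨δ, hδ, h⟩ := lowNum_den_mutate T k
  have hD := lowDet_eq_one_or T (i := k + 1) (j := k + 2) (by simp)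
  have hY := lowNum_den_of_num_nonneg (T.mutate_q_add_one k ▸ hT' (k + 1))
  have hZ := lowNum_den_of_num_nonneg (T.mutate_q_add_two k ▸ hT' (k + 2))
  have e11 : k + 1 + 1 = k + 2 := add_assoc k 1 1
  have e12 : k + 1 + 2 = k := (add_assoc k 1 2).trans (add_zero k)
  have e21 : k + 2 + 1 = k := (add_assoc k 2 1).trans (add_zero k)
  have e22 : k + 2 + 2 = k + 1 := add_assoc k 2 2
  -- Whichever of the old and new components is the difference, it lies in `[0, ∞]`. In the second
  -- alternative of `hT` the old one is the sum, so the new one is the difference.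
  have hO : (0 ≤ δ * (lowNum (T.q (k + 2)) - lowNum (T.q (k + 1))) ∧
        1 ≤ δ * (den (T.q (k + 2)) - den (T.q (k + 1)))) ∨
      (δ * (lowNum (T.q (k + 2)) - lowNum (T.q (k + 1))) = -1 ∧
        δ * (den (T.q (k + 2)) - den (T.q (k + 1))) = 0) := by
    rcases h with ⟨-, -, h1, h2⟩ | ⟨-, -, h1, h2⟩
    · rw [← h1, ← h2]; exact lowNum_den_of_num_nonneg (hT' k)
    · rcases hT with hT | ⟨h3, h4⟩
      · rw [← h1, ← h2]; exact lowNum_den_of_num_nonneg (hT k)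
      · exfalso
        rw [h3] at h1
        rw [h4] at h2
        rw [lowDet] at hD
        rcases hδ with rfl | rfl
        · rw [show lowNum (T.q (k + 1)) = 0 by omega, show den (T.q (k + 1)) = 0 by omega] at hD
          omega
        · rw [show lowNum (T.q (k + 2)) = 0 by omega, show den (T.q (k + 2)) = 0 by omega] at hD
          omega
  have hc := sign_coherence hδ (D := lowDet T (k + 1) (k + 2)) rfl hD rfl rfl hY hZ hO
  have hσ := orientation_eq T k
  have hσ' := orientation_eq (T.mutate k) k
  refine ⟨δ, hδ, ?_⟩
  simp only [cVec, gVec, e11, e12, e21, e22]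
  rw [hσ, hσ']
  simp only [lowDet, mutate_q_add_one, mutate_q_add_two] at *
  generalize lowNum (T.q k) = x at *
  generalize den (T.q k) = y at *
  generalize lowNum ((T.mutate k).q k) = x' at *
  generalize den ((T.mutate k).q k) = y' at *
  generalize lowNum (T.q (k + 1)) = a at *
  generalize den (T.q (k + 1)) = c at *
  generalize lowNum (T.q (k + 2)) = b at *
  generalize den (T.q (k + 2)) = d at *
  clear hσ hσ' hT hT' hY hZ hO
  -- By these identities the orientation is `-D` if component `k` is the sum and `D` if it is the
  -- difference, so mutation reverses it.
  have i1 : (a + b) * c - a * (c + d) = -(a * d - b * c) := by ring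
  have i2 : b * (c + d) - (a + b) * d = -(a * d - b * c) := by ring
  have i3 : δ * (b - a) * c - a * (δ * (d - c)) = -δ * (a * d - b * c) := by ring
  have i4 : b * (δ * (d - c)) - δ * (b - a) * d = δ * (a * d - b * c) := by ring
  rcases h with ⟨rfl, rfl, rfl, rfl⟩ | ⟨rfl, rfl, rfl, rfl⟩
  all_goals
    rw [i1, i2, i3, i4]
    generalize a * d - b * c = D at *
    clear i1 i2 i3 i4
    rcases hδ with rfl | rfl <;> rcases hD with rfl | rfl <;>
      refine ⟨by norm_num, fun m => ?_, fun m => ?_, fun m => ?_, fun m => ?_, fun m => ?_⟩ <;>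
      fin_cases m <;> simp [cVecAux] <;> omega

/-! ### Seeds attached to Farey triples -/

/-- The seed `S` has the exchange matrix, the c-vectors and the g-vectors attached to `T`. -/
structure Describes (T : FareyTriple) (S : Seed (Fin 3)) : Prop where
  mat_inl : ∀ i j, S.mat (Sum.inl i) j = orientation T * exchangeMatrix i j
  mat_inr : ∀ m j, S.mat (Sum.inr m) j = cVec T j m
  degree : ∀ j, HasDegree exchangeMatrix (S.var j) (gVec T j)

/-- The Markov quiver is a 3-cycle of double arrows: off row and column `k`, an off-diagonal entry
`±2` receives the correction `∓4`. -/
theorem mutateMatrix_inl {B : Matrix (Fin 3 ⊕ Fin 3) (Fin 3) ℤ} {σ : ℤ} (hσ : σ = 1 ∨ σ = -1)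
    (h : ∀ i j, B (Sum.inl i) j = σ * exchangeMatrix i j) (k i j : Fin 3) :
    mutateMatrix B k (Sum.inl i) j = -σ * exchangeMatrix i j := by
  simp only [mutateMatrix, Matrix.of_apply, h, Sum.inl.injEq]
  rcases hσ with rfl | rfl
  · revert k i j; decide
  · revert k i j; decide

theorem sign_mul_max_of_nonneg {c : ℤ} (hc : 0 ≤ c) (t : ℤ) :
    c.sign * max (c * t) 0 = c * max t 0 := by
  rcases hc.eq_or_lt with rfl | hc'
  · simp
  · rw [Int.sign_eq_one_of_pos hc', one_mul, mul_max_of_nonneg _ _ hc, mul_zero]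

theorem sign_mul_max_of_nonpos {c : ℤ} (hc : c ≤ 0) (t : ℤ) :
    c.sign * max (c * t) 0 = c * max (-t) 0 := by
  have := sign_mul_max_of_nonneg (neg_nonneg.mpr hc) (-t)
  rw [Int.sign_neg, neg_mul_neg] at this
  linarith

theorem exchangeMatrix_cyclic (k : Fin 3) : exchangeMatrix k k = 0 ∧
    exchangeMatrix (k + 1) k = 2 ∧ exchangeMatrix (k + 2) k = -2 ∧
    exchangeMatrix k (k + 1) = -2 ∧ exchangeMatrix k (k + 2) = 2 := by
  revert k; decide

theorem sum_fin_three_cyclic {M : Type*} [AddCommMonoid M] (f : Fin 3 → M) (k : Fin 3) :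
    ∑ i, f i = f k + f (k + 1) + f (k + 2) := by
  rw [Fin.sum_univ_three]
  fin_cases k <;> simp <;> abel

/-- The exchange relations are homogeneous. -/
theorem sum_cVec_mul (T : FareyTriple) (k x : Fin 3) :
    ∑ m, cVec T k m * -exchangeMatrix x m
      = -(2 * orientation T) * (gVec T (k + 1) x - gVec T (k + 2) x) := by
  rw [Fin.sum_univ_three]
  fin_cases x <;> simp [cVec, cVecAux, gVec, exchangeMatrix] <;> ring

/-- The second alternative in `hT` admits the initial triple, which is not nonnegative because of
`-1/1`. -/
theorem Describes.mutate {T : FareyTriple} {S : Seed (Fin 3)} (hS : S.IsPositive)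
    (h : Describes T S) {k : Fin 3} (hT' : (T.mutate k).IsNonneg)
    (hT : T.IsNonneg ∨ (lowNum (T.q k) = lowNum (T.q (k + 1)) + lowNum (T.q (k + 2)) ∧
        den (T.q k) = den (T.q (k + 1)) + den (T.q (k + 2)))) :
    Describes (T.mutate k) (S.mutate k) := by
  obtain ⟨δ, hδ, hσ', hg, hc0, hc1, hc2, hpos⟩ := exists_sign_mutate hT' hT
  have hσ := orientation_eq_one_or T
  obtain ⟨b0, b1, b2, b3, b4⟩ := exchangeMatrix_cyclic k
  -- Sign-coherence: the common sign of the c-vector is `orientation T * δ`, which ties the exchange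
  -- relation to the Farey mutation.
  have hcases : (∀ m, 0 ≤ cVec T k m) ∧ δ = orientation T ∨
      (∀ m, cVec T k m ≤ 0) ∧ δ = -orientation T := by
    rcases hδ with rfl | rfl <;> rcases hσ with h | h <;> rw [h] at hpos
    · exact Or.inl ⟨fun m => by simpa using hpos m, h.symm⟩
    · exact Or.inr ⟨fun m => by simpa using hpos m, by omega⟩
    · exact Or.inr ⟨fun m => by simpa using hpos m, by omega⟩
    · exact Or.inl ⟨fun m => by simpa using hpos m, h.symm⟩
  refine ⟨fun i j => ?_, fun m j => ?_, fun j => ?_⟩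
  · rw [hσ']; exact mutateMatrix_inl hσ h.mat_inl k i j
  · have hm : ∀ j, j ≠ k → (S.mutate k).mat (Sum.inr m) j = cVec T j m +
        (cVec T k m).sign * max (cVec T k m * (orientation T * exchangeMatrix k j)) 0 := by
      intro j hj
      simp [Seed.mutate, mutateMatrix, hj, h.mat_inr, h.mat_inl]
    refine forall_fin_three_of_cyclic
      (P := fun j => (S.mutate k).mat (Sum.inr m) j = cVec (T.mutate k) j m) k ?_ ?_ ?_ j
    · rw [hc0, ← h.mat_inr]; simp [Seed.mutate, mutateMatrix]
    · rw [hm _ (by simp), hc1, b3]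
      rcases hcases with ⟨h1, rfl⟩ | ⟨h1, rfl⟩
      · rw [sign_mul_max_of_nonneg (h1 m), mul_comm (cVec T k m)]
        rcases hσ with h | h <;> rw [h] <;> norm_num
      · rw [sign_mul_max_of_nonpos (h1 m), mul_comm (cVec T k m)]
        rcases hσ with h | h <;> rw [h] <;> norm_num
    · rw [hm _ (by simp), hc2, b4]
      rcases hcases with ⟨h1, rfl⟩ | ⟨h1, rfl⟩
      · rw [sign_mul_max_of_nonneg (h1 m), mul_comm (cVec T k m)]
        rcases hσ with h | h <;> rw [h] <;> norm_num
      · rw [sign_mul_max_of_nonpos (h1 m), mul_comm (cVec T k m)]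
        rcases hσ with h | h <;> rw [h] <;> norm_num
  · by_cases hj : j = k
    · subst hj
      have := Seed.hasDegree_mutate hS h.degree j (by
        funext x
        have hx := sum_cVec_mul T j x
        simp only [Fintype.sum_sum_type, Sum.elim_inl, Sum.elim_inr, h.mat_inl, h.mat_inr,
          Finset.sum_apply, Pi.smul_apply, smul_eq_mul, degWeight, Pi.zero_apply]
        rw [hx, sum_fin_three_cyclic _ j, b0, b1, b2]
        ring)
      convert this using 1
      funext x
      have hx := sum_cVec_mul T j x
      simp only [Fintype.sum_sum_type, Sum.elim_inl, Sum.elim_inr, h.mat_inl, h.mat_inr,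
        Pi.add_apply, Pi.sub_apply, Finset.sum_apply, Pi.smul_apply, smul_eq_mul, degWeight]
      rw [hg, sum_fin_three_cyclic _ j, b0, b1, b2]
      -- The degree is computed on the monomial of positive exponents. If `c ≥ 0`, homogeneity
      -- trades the coefficient degrees for g-vectors; if `c ≤ 0`, that monomial has no
      -- coefficients.
      rcases hcases with ⟨h1, rfl⟩ | ⟨h1, rfl⟩
      · simp only [max_eq_left (h1 _), hx]
        rcases hσ with h | h <;> rw [h] <;> norm_num <;> ring
      · simp only [max_eq_right (h1 _)]
        rcases hσ with h | h <;> rw [h] <;> norm_num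
    · have e1 : (S.mutate k).var j = S.var j := Function.update_of_ne hj ..
      have e2 : gVec (T.mutate k) j = gVec T j := by rw [gVec, gVec, mutate_q_of_ne _ hj]
      rw [e1, e2]
      exact h.degree j

/-- With `∞ = -1/0` the initial triple also obeys the formulas: both its g-matrix and its c-matrix
come out as the identity. -/
theorem describes_initial : Describes initial (initialSeed exchangeMatrix) := by
  have h0 : lowNum (initial.q 0) = 0 ∧ den (initial.q 0) = 1 := ⟨rfl, rfl⟩
  have h1 : lowNum (initial.q 1) = -1 ∧ den (initial.q 1) = 1 := ⟨rfl, rfl⟩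
  have h2 : lowNum (initial.q 2) = -1 ∧ den (initial.q 2) = 0 := ⟨rfl, rfl⟩
  have ho : orientation initial = 1 := by simp [orientation, lowDet, h0, h1, h2]
  refine ⟨fun i j => ?_, fun m j => ?_, fun j => ?_⟩
  · simp [initialSeed, ho]
  · simp only [initialSeed, Matrix.fromRows_apply_inr]
    fin_cases m <;> fin_cases j <;> simp [cVec, cVecAux, ho, lowDet, h0, h1, h2]
  · change HasDegree _ (gen (Sum.inl j)) _
    convert hasDegree_gen exchangeMatrix (Sum.inl j) using 1
    funext x
    fin_cases x <;> fin_cases j <;> simp [gVec, degWeight, h0, h1, h2]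

/-! ### Words of mutations and independence of the word. -/

theorem seed_mutateWord_append_singleton (S : Seed (Fin 3)) (w : List (Fin 3)) (k : Fin 3) :
    S.mutateWord (w ++ [k]) = (S.mutateWord w).mutate k := by
  simp [Seed.mutateWord]

theorem isPositive_mutateWord (w : List (Fin 3)) :
    ((initialSeed exchangeMatrix).mutateWord w).IsPositive := by
  induction w using List.reverseRecOn with
  | nil => exact fun i => isPositive_gen _
  | append_singleton w k ih => rw [seed_mutateWord_append_singleton]; exact ih.mutate k

/-- This holds for all words, also outside `[0, ∞]`; it supplies the zero diagonal entry required by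
`Seed.mutate_mutate`. -/
theorem exists_sign_mutateWord_mat (w : List (Fin 3)) : ∃ σ : ℤ, (σ = 1 ∨ σ = -1) ∧
    ∀ i j, ((initialSeed exchangeMatrix).mutateWord w).mat (Sum.inl i) j
      = σ * exchangeMatrix i j := by
  induction w using List.reverseRecOn with
  | nil => exact ⟨1, Or.inl rfl, fun i j => by simp [Seed.mutateWord, initialSeed]⟩
  | append_singleton w k ih =>
    obtain ⟨σ, hσ, h⟩ := ih
    refine ⟨-σ, by omega, fun i j => ?_⟩
    rw [seed_mutateWord_append_singleton]
    exact mutateMatrix_inl hσ h k i j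

/-- Every word may be replaced by a reduced word leading to the same triple and the same seed. -/
theorem exists_reduced_word (w : List (Fin 3)) : ∃ w' : List (Fin 3), w'.IsChain (· ≠ ·) ∧
    initial.mutateWord w' = initial.mutateWord w ∧
    (initialSeed exchangeMatrix).mutateWord w' = (initialSeed exchangeMatrix).mutateWord w := by
  induction w using List.reverseRecOn with
  | nil => exact ⟨[], List.isChain_nil, rfl, rfl⟩
  | append_singleton w k ih =>
    obtain ⟨v, hv, h1, h2⟩ := ih
    rw [mutateWord_append_singleton, seed_mutateWord_append_singleton, ← h1, ← h2]
    rcases List.eq_nil_or_concat' v with rfl | ⟨u, j, rfl⟩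
    · exact ⟨[k], List.isChain_singleton _, rfl, rfl⟩
    · by_cases hjk : j = k
      · subst hjk
        refine ⟨u, hv.left_of_append, ?_, ?_⟩
        · rw [mutateWord_append_singleton, mutate_mutate]
        · rw [seed_mutateWord_append_singleton, Seed.mutate_mutate _ _ (isPositive_mutateWord u)]
          obtain ⟨σ, -, h⟩ := exists_sign_mutateWord_mat u
          rw [h, (exchangeMatrix_cyclic j).1, mul_zero]
      · refine ⟨u ++ [j] ++ [k], ?_, mutateWord_append_singleton _ _ _,
          seed_mutateWord_append_singleton _ _ _⟩
        rw [List.isChain_append]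
        refine ⟨hv, List.isChain_singleton _, ?_⟩
        simpa using hjk

theorem describes_mutateWord {w : List (Fin 3)} (hw : w.IsChain (· ≠ ·))
    (h : (initial.mutateWord w).IsNonneg) :
    Describes (initial.mutateWord w) ((initialSeed exchangeMatrix).mutateWord w) := by
  induction w using List.reverseRecOn with
  | nil => exact absurd h not_isNonneg_initial
  | append_singleton w k ih =>
    have hw' : w.IsChain (· ≠ ·) := hw.left_of_append
    rw [mutateWord_append_singleton] at h ⊢
    rw [seed_mutateWord_append_singleton]
    by_cases hT : (initial.mutateWord w).IsNonneg
    · exact (ih hw' hT).mutate (isPositive_mutateWord w) h (Or.inl hT)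
    -- The last step enters `[0, ∞]`, so it starts at the initial triple. Reducedness then leaves
    -- only the empty prefix, and the seed there is the initial one.
    · obtain ⟨h1, rfl⟩ := eq_initial_of_mutate_isNonneg hT h
      obtain rfl : w = [] := by
        by_contra hne
        exact mutateWord_ne_initial hne hw' h1
      -- In the normalized vectors, `(-1, 1) = (-1, 0) + (0, 1)`: the component `-1/1` is the sum of
      -- the other two.
      exact describes_initial.mutate (isPositive_mutateWord []) h (Or.inr ⟨rfl, rfl⟩)

/-- The g-matrix attached to a Farey triple. -/
def gMatrix (T : FareyTriple) : Matrix (Fin 3) (Fin 3) ℤ := Matrix.of fun i j => gVec T j i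

theorem isAssociatedGMatrix_iff {T : FareyTriple} (hT : T ∈ branch 1)
    (M : Matrix (Fin 3) (Fin 3) ℤ) : IsAssociatedGMatrix T M ↔ M = gMatrix T := by
  have hn := isNonneg_of_mem_branch hT
  constructor
  · rintro ⟨w, rfl, hM⟩
    obtain ⟨v, hv, h1, h2⟩ := exists_reduced_word w
    have := describes_mutateWord hv (h1 ▸ hn)
    rw [h1, h2] at this
    ext i j
    exact congrFun ((hM j).unique (this.degree j)) i
  · rintro rfl
    obtain ⟨w, rfl⟩ := exists_mutateWord_of_mem_branch hT
    obtain ⟨v, hv, h1, h2⟩ := exists_reduced_word w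
    exact ⟨v, h1, h1 ▸ (describes_mutateWord hv (h1 ▸ hn)).degree⟩

theorem gMatrix_eq (T : FareyTriple) : gMatrix T =
    !![lowNum (T.q 0) + 1, lowNum (T.q 1) + 1, lowNum (T.q 2) + 1;
       den (T.q 0) - lowNum (T.q 0) - 1, den (T.q 1) - lowNum (T.q 1) - 1,
         den (T.q 2) - lowNum (T.q 2) - 1;
       1 - den (T.q 0), 1 - den (T.q 1), 1 - den (T.q 2)] := by
  ext i j
  fin_cases i <;> fin_cases j <;> rfl

end Markov

/-! ### Translation of the uniform formula into the three cases. -/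

namespace Farey

theorem lowNum_intCast (a : ℤ) : lowNum ((a : ℚ) : ExtRat) = a := by
  simp [lowNum, num]

theorem den_intCast (a : ℤ) : den ((a : ℚ) : ExtRat) = 1 := by
  simp [den]

theorem eq_intCast_of_den_eq_one {q : ExtRat} (h : den q = 1) : q = ((num q : ℚ) : ExtRat) :=
  ext_of_num_den (by simp [num]) (by rw [h, den_intCast])

theorem lowNum_of_ne_top {q : ExtRat} (h : q ≠ ⊤) : lowNum q = num q := if_neg h

theorem den_eq_one_of_neighbors_top {q : ExtRat} (h : Neighbors q ⊤) : den q = 1 := by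
  rw [neighbors_iff] at h
  have h1 : num (⊤ : ExtRat) = 1 := rfl
  have h2 : den (⊤ : ExtRat) = 0 := rfl
  rw [h1, h2] at h
  have := den_nonneg q
  omega

theorem ne_top_of_odd_den {q : ExtRat} (h : Odd (den q)) : q ≠ ⊤ := by
  rintro rfl
  exact absurd h (by decide)

end Farey

theorem mainTheorem2 (T : Farey.FareyTriple) (hT : T ∈ Farey.branch 1) :
    -- the three cases cover all triples of the branch
    (T.q 2 = ⊤ → ∃ a : ℤ, T.q 0 = ((a : ℚ) : Farey.ExtRat) ∧
      (T.q 1 = (((a - 1 : ℤ) : ℚ) : Farey.ExtRat) ∨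
        T.q 1 = (((a + 1 : ℤ) : ℚ) : Farey.ExtRat))) ∧
    -- (i)
    (∀ a : ℤ, T.q 0 = ((a : ℚ) : Farey.ExtRat) →
      T.q 1 = (((a - 1 : ℤ) : ℚ) : Farey.ExtRat) → T.q 2 = ⊤ →
      ∀ M : Matrix (Fin 3) (Fin 3) ℤ, Markov.IsAssociatedGMatrix T M ↔
        M = !![a + 1, a, 0;
               -a, -a + 1, 0;
               0, 0, 1]) ∧
    -- (ii)
    (∀ a : ℤ, T.q 0 = ((a : ℚ) : Farey.ExtRat) →
      T.q 1 = (((a + 1 : ℤ) : ℚ) : Farey.ExtRat) → T.q 2 = ⊤ →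
      ∀ M : Matrix (Fin 3) (Fin 3) ℤ, Markov.IsAssociatedGMatrix T M ↔
        M = !![a + 1, a + 2, 0;
               -a, -(a + 1), 0;
               0, 0, 1]) ∧
    -- (iii)
    (∀ a b c d e f : ℤ,
      a = Farey.num (T.q 0) → b = Farey.den (T.q 0) →
      c = Farey.num (T.q 1) → d = Farey.den (T.q 1) →
      e = Farey.num (T.q 2) → f = Farey.den (T.q 2) → T.q 2 ≠ ⊤ →
      ∀ M : Matrix (Fin 3) (Fin 3) ℤ, Markov.IsAssociatedGMatrix T M ↔
        M = !![a + 1, c + 1, e + 1;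
               b - a - 1, d - c - 1, f - e - 1;
               1 - b, 1 - d, 1 - f]) := by
  have hM := Markov.isAssociatedGMatrix_iff hT
  have h0 : T.q 0 ≠ ⊤ := Farey.ne_top_of_odd_den (T.parity 0).2
  have h1 : T.q 1 ≠ ⊤ := Farey.ne_top_of_odd_den (T.parity 1).2
  refine ⟨fun h2 => ?_, fun a ha hc h2 M => ?_, fun a ha hc h2 M => ?_, ?_⟩
  · have d0 := Farey.den_eq_one_of_neighbors_top (h2 ▸ T.neighbors 0 2 (by decide))
    have d1 := Farey.den_eq_one_of_neighbors_top (h2 ▸ T.neighbors 1 2 (by decide))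
    have hn := (Farey.neighbors_iff _ _).mp (T.neighbors 0 1 (by decide))
    rw [d0, d1, mul_one, mul_one] at hn
    refine ⟨Farey.num (T.q 0), Farey.eq_intCast_of_den_eq_one d0, ?_⟩
    rcases hn with hn | hn
    · left
      rw [show Farey.num (T.q 0) - 1 = Farey.num (T.q 1) by omega]
      exact Farey.eq_intCast_of_den_eq_one d1
    · right
      rw [show Farey.num (T.q 0) + 1 = Farey.num (T.q 1) by omega]
      exact Farey.eq_intCast_of_den_eq_one d1
  -- The third column comes from `∞` as the vector `(-1, 0)`, which gives `(0, 0, 1)`.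
  · rw [hM, Markov.gMatrix_eq, ha, hc, h2, Farey.lowNum_intCast, Farey.lowNum_intCast,
      Farey.den_intCast, Farey.den_intCast, show Farey.lowNum ⊤ = -1 from rfl,
      show Farey.den ⊤ = 0 from rfl]
    ring_nf
  · rw [hM, Markov.gMatrix_eq, ha, hc, h2, Farey.lowNum_intCast, Farey.lowNum_intCast,
      Farey.den_intCast, Farey.den_intCast, show Farey.lowNum ⊤ = -1 from rfl,
      show Farey.den ⊤ = 0 from rfl]
    ring_nf
  · rintro a b c d e f rfl rfl rfl rfl rfl rfl h2 M
    rw [hM, Markov.gMatrix_eq, Farey.lowNum_of_ne_top h0, Farey.lowNum_of_ne_top h1,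
      Farey.lowNum_of_ne_top h2]
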